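/- **Theorem 1.1.** Let $n\ge 1$ be an integer, $\mathbb{Z}_n=\mathbb{Z}/n\mathbb{Z}$, and let $\mathbb{T}_n=[0,1)\times\mathbb{Z}_n$ be the semi-discrete torus, consisting of $n$ strings $[0,1)\times\{h\}$ and carrying Lebesgue measure on each string. For $k\ge 1$, a bead configuration with $k$ beads per string is a set of $nk$ distinct points of $\mathbb{T}_n$, $k$ on each string, such that for every $h\in\mathbb{Z}_n$ the points $t_1<\dots<t_k$ of string $h$ and $t_1'<\dots<t_k'$ of string $h+1$ interlace: either $t_1\le t_1'<t_2\le\dots<t_k\le t_k'$ or $t_1'<t_1\le t_2'<\dots\le t_k'<t_k$. Its occupation process $(X_t)_{t\in[0,1)}$ is obtained by drawing, from the position above each bead (a bead at $(s,h)$ giving the starting point $(s,h+1)$), a thick line travelling rightwards, cyclically, until it hits a bead of that string; $X_t\subseteq\mathbb{Z}_n$ is the set of strings carrying a thick line at time $t$. The configuration is an $(n,k,\ell)$ configuration if $\# X_t=\ell$ for all $t$. Let $\mathrm{Vol}^{(n)}_{k,\ell}$ be the volume of the set of $(n,k,\ell)$ configurations, regarded as a subset of $[0,1)^{nk}$ through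 the positions $t_{h,1}<\dots<t_{h,k}$ of the beads on each string $h$, and let $\widetilde{\mathrm{Vol}}{}^{(n)}_{k,\ell}$ be the volume of the set of $(x_1,\dots,x_{nk})\in\mathbb{T}_n^{nk}$ whose entries, in any order, are the points of an $(n,k,\ell)$ configuration. For $k=0$ there is an empty configuration for each choice of the $\ell$ strings occupied at all times, so that $\mathrm{Vol}^{(n)}_{0,\ell}=\widetilde{\mathrm{Vol}}{}^{(n)}_{0,\ell}=\binom n\ell$. For $\lambda\in\mathbb{C}$ let $g_0^\lambda=\sum_{\ell=0}^n\binom n\ell e^{-\lambda\ell}$ and, for $N\ge1$, let $g_N^\lambda(x_1,\dots,x_N)=e^{-\lambda\ell}$ if $N=nk$ and $x_1,\dots,x_N$ are the points, in any order, of an $(n,k,\ell)$ configuration for some $k,\ell$, and $g_N^\lambda(x_1,\dots,x_N)=0$ otherwise. Then for all $\lambda,T\in\mathbb{C}$ the functions $g_N^\lambda$ are integrable, the following series converge absolutely, and $$Z_n(\lambda,T):=\sum_{N\ge0}\frac{T^N}{N!}\int_{\mathbb{T}_n^N}g_N^\lambda(x_1,\dots,x_N)\,dx_1\cdots dx_N=\sum_{k\ge0,\,0\le\ell\le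 n}\frac{T^{nk}}{(nk)!}e^{-\lambda\ell}\,\widetilde{\mathrm{Vol}}{}^{(n)}_{k,\ell}=\sum_{k\ge0,\,0\le\ell\le n}T^{nk}e^{-\lambda\ell}\,\mathrm{Vol}^{(n)}_{k,\ell}$$ $$=\frac12\sum_{\theta=(\theta_1,\theta_2)\in\{0,1\}^2}(-1)^{(\theta_1+1)(\theta_2+n+1)}\prod_{w\in\mathbb{C}:\,w^n=(-1)^{\theta_2}}\left(e^{Tw}-(-1)^{\theta_1}e^{-\lambda}\right).$$ -/

import Mathlib

open MeasureTheory Set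
open scoped Nat

namespace BeadModel

noncomputable section

/-- Interlacing of the `k` ordered points `s` of a string with the `k` ordered points `s'` of the
next string: either `s_1 ≤ s'_1 < s_2 ≤ s'_2 < ... < s_k ≤ s'_k`, or
`s'_1 < s_1 ≤ s'_2 < s_2 ≤ ... ≤ s'_k < s_k`. -/
def Interlace {k : ℕ} (s s' : Fin k → ℝ) : Prop :=
  ((∀ j, s j ≤ s' j) ∧ ∀ i j : Fin k, (i : ℕ) + 1 = j → s' i < s j) ∨
  ((∀ j, s' j < s j) ∧ ∀ i j : Fin k, (i : ℕ) + 1 = j → s i ≤ s' j)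

/-- `t h j` is the position of the `j`-th bead on the string `h`; the strings are indexed by the
cyclic group `ℤ/nℤ`, and each has `k` beads, listed from left to right. -/
structure IsBeadConfig {n k : ℕ} (t : ZMod n → Fin k → ℝ) : Prop where
  mem_Ico : ∀ h j, t h j ∈ Ico (0 : ℝ) 1
  strictMono : ∀ h, StrictMono (t h)
  interlace : ∀ h, Interlace (t h) (t (h + 1))

/-- The points of the circle `[0,1)` met when travelling rightwards from `s` to `τ`, both ends
included. -/
def cyclicIcc (s τ : ℝ) : Set ℝ :=
  if s ≤ τ then Icc s τ else Ico s 1 ∪ Icc 0 τ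

/-- The set `X_τ` of strings occupied at time `τ`. A thick line is drawn from the position above
any bead (on the string `h - 1`, say, so that the line is on the string `h`), rightwards and
cyclically, until it hits a bead of the string `h`. -/
def occupation {n k : ℕ} (t : ZMod n → Fin k → ℝ) (τ : ℝ) : Set (ZMod n) :=
  {h | ∃ i : Fin k, ∀ j : Fin k, t h j ∉ cyclicIcc (t (h - 1) i) τ}

/-- The bead configurations with `k` beads on each of `n` strings and occupation number `ℓ`. -/
def configs (n k ℓ : ℕ) : Set (ZMod n → Fin k → ℝ) :=
  {t | IsBeadConfig t ∧ ∀ τ ∈ Ico (0 : ℝ) 1, (occupation t τ).ncard = ℓ}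

/-- The volume of the `(n,k,ℓ)` configurations as a subset of `[0,1)^{nk}`. Without beads, any
`ℓ` of the `n` strings may be the ones that are occupied at all times, so that there are
`n.choose ℓ` empty configurations with occupation number `ℓ`. -/
def Vol (n k ℓ : ℕ) [NeZero n] : ℝ :=
  if k = 0 then (n.choose ℓ : ℝ) else (volume (configs n k ℓ)).toReal

/-- The points `x_1, ..., x_N` of the semi-discrete torus `[0,1) × ℤ/nℤ`, in any order, are the
beads of an `(n,k,ℓ)` configuration (in particular `N = nk`). -/
def IsConfig {n N : ℕ} (k ℓ : ℕ) (x : Fin N → ℝ × ZMod n) : Prop :=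
  ∃ t ∈ configs n k ℓ, ∃ e : Fin N ≃ ZMod n × Fin k,
    ∀ i, x i = (t (e i).1 (e i).2, (e i).1)

open Classical in
/-- The function `g_N^λ` on `N`-tuples of points of the torus: it is `e^{-λℓ}` if the points form
an `(n,k,ℓ)` configuration for some `k, ℓ`, where `ℓ` is unique for `N ≥ 1`, and `0` otherwise.
For `N = 0` all empty configurations, `n.choose ℓ` for each `ℓ`, are counted. -/
def g (n N : ℕ) (lam : ℂ) (x : Fin N → ℝ × ZMod n) : ℂ :=
  if N = 0 then ∑ ℓ ∈ Finset.range (n + 1), (n.choose ℓ : ℂ) * Complex.exp (-lam * ℓ)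
  else ∑ ℓ ∈ Finset.range (n + 1),
    if ∃ k, IsConfig k ℓ x then Complex.exp (-lam * ℓ) else 0

/-- Lebesgue measure on the semi-discrete torus `[0,1) × ℤ/nℤ`, i.e. on each of the `n` strings. -/
def torusMeasure (n : ℕ) : Measure (ℝ × ZMod n) :=
  (volume.restrict (Ico (0 : ℝ) 1)).prod Measure.count

/-- Product Lebesgue measure on `N`-tuples of points of the torus. -/
def torusMeasurePow (n N : ℕ) [NeZero n] : Measure (Fin N → ℝ × ZMod n) :=
  Measure.pi fun _ => torusMeasure n

/-- The volume of the set of `(n,k,ℓ)` configurations with labelled beads, as a subset of the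
`nk`-th power of the torus; for `k = 0` there are `n.choose ℓ` empty configurations. -/
def labelledVol (n k ℓ : ℕ) [NeZero n] : ℝ :=
  if k = 0 then (n.choose ℓ : ℝ)
  else (torusMeasurePow n (n * k) {x | IsConfig k ℓ x}).toReal

/-- The partition function `Z_n(λ, T) = ∑_N T^N / N! ∫ g_N^λ(x_1, ..., x_N) dx_1 ... dx_N`. -/
def Z (n : ℕ) [NeZero n] (lam T : ℂ) : ℂ :=
  ∑' N : ℕ, T ^ N / (N ! : ℂ) * ∫ x, g n N lam x ∂(torusMeasurePow n N)

end

end BeadModel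

/-!
A bead on the string `h` moves a thick line from the string `h` to `h + 1`. Read from left to right,
a configuration with `N = nk` beads at distinct times is therefore a word of `N` strings, along which
a set of `ℓ` particles on `ℤ/nℤ`, the occupied strings, hops to the right and returns to its initial
position; no two particles may share a site. It is convenient to follow the `m = n - ℓ` unoccupied
strings instead, the holes, which hop to the left: in this form the correspondence
(`isConfig_iff_isConfigWord`, `IsWalk.isConfigWord`, `IsConfigWord.isWalk`) also covers `n = 1`,
where the only hole may hop to its own place.

Among `N` points with given labels, each of the `N!` orders has volume `1 / N!`, so the labelled
volume is the number of closed words, which is the trace of `H_m ^ N` for the transfer matrix `H_m`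
of `m` holes (`torusMeasurePow_exists_isConfig`). The beads of a configuration can be labelled in
`N!` ways, so the unlabelled volume is smaller by this factor (`labelledVol_eq_factorial_mul_Vol`).

The holes are free fermions. The Slater determinants `det (w_i ^ (-x_j))` of `m` distinct `n`-th
roots `w_i` of `(-1) ^ (m + 1)` are eigenvectors of `H_m` with eigenvalue `∑ w_i`: a hop onto an
occupied site contributes a determinant with two equal columns, and the sign produced by a hole that
passes from the site `0` to `n - 1` is compensated by `w_i ^ n` (`slater_update`). By the
Cauchy–Binet formula and the orthogonality of plane waves they form a basis, so that
`tr H_m ^ N = ∑_W (∑_{w ∈ W} w) ^ N`, where `W` runs through the `m`-element sets of roots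
(`trace_hopMatrix_pow`). Summing `T ^ N / N!` times this over `N` gives the elementary symmetric
polynomials of the `e ^ (T w)`, which are the coefficients of the products over the roots of `1` and
of `-1`; the sum over `θ` takes from each product the terms of the right parity (`half_sum_sign`).
-/

namespace BeadModel

/-! ### Interlacing, occupation numbers and the index shift -/

/-- The points `s'` lie to the left of `s i` exactly up to the index `i + ε`. For `ε = 0` and
`ε = 1` these are the two ways in which `s` and `s'` may interlace; `ε` says whether
the string of `s'` is occupied at time `0`, just before its first bead. -/
def Shifted {k : ℕ} (ε : ℕ) (s s' : Fin k → ℝ) : Prop :=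
  ∀ i j : Fin k, s' j < s i ↔ (j : ℕ) < i + ε

theorem interlace_iff_shifted {k : ℕ} {s s' : Fin k → ℝ} (hs : StrictMono s)
    (hs' : StrictMono s') : Interlace s s' ↔ Shifted 0 s s' ∨ Shifted 1 s s' := by
  unfold Interlace Shifted
  refine or_congr ⟨fun ⟨h1, h2⟩ i j => ⟨fun h => ?_, fun h => ?_⟩, fun h => ⟨fun j => ?_,
    fun i j hij => ?_⟩⟩ ⟨fun ⟨h1, h2⟩ i j => ⟨fun h => ?_, fun h => ?_⟩, fun h => ⟨fun j => ?_,
    fun i j hij => ?_⟩⟩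
  · by_contra hc
    exact absurd h (not_lt.2 ((h1 i).trans (hs'.monotone (Fin.le_def.2 (by omega)))))
  · have hj : (j : ℕ) + 1 < k := by have := i.2; omega
    exact (h2 j ⟨j + 1, hj⟩ rfl).trans_le (hs.monotone (Fin.le_def.2 (by simp; omega)))
  · exact not_lt.1 fun hc => by have := (h j j).1 hc; omega
  · exact (h j i).2 (by omega)
  · by_contra hc
    have hi : (i : ℕ) + 1 < k := by have := j.2; omega
    exact absurd h (not_lt.2 ((h2 i ⟨i + 1, hi⟩ rfl).trans
      (hs'.monotone (Fin.le_def.2 (by simp; omega)))))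
  · exact (hs'.monotone (Fin.le_def.2 (by omega))).trans_lt (h1 i)
  · exact (h j j).2 (by omega)
  · exact not_lt.1 fun hc => by have := (h i j).1 hc; omega

/-- The number of points of `s` up to time `τ`. -/
noncomputable def countLE {k : ℕ} (s : Fin k → ℝ) (τ : ℝ) : ℕ :=
  (Finset.univ.filter fun j => s j ≤ τ).card

theorem countLE_le {k : ℕ} (s : Fin k → ℝ) (τ : ℝ) : countLE s τ ≤ k :=
  (Finset.card_le_univ _).trans_eq (by simp)

theorem le_iff_lt_countLE {k : ℕ} {s : Fin k → ℝ} (hs : StrictMono s) (τ : ℝ) (i : Fin k) :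
    s i ≤ τ ↔ (i : ℕ) < countLE s τ := by
  unfold countLE
  constructor
  · intro h
    have : Finset.Iic i ⊆ Finset.univ.filter fun j => s j ≤ τ := fun j hj => by
      simpa using (hs.monotone (Finset.mem_Iic.1 hj)).trans h
    simpa using Finset.card_le_card this
  · intro h
    by_contra hc
    have : (Finset.univ.filter fun j => s j ≤ τ) ⊆ Finset.Iio i := fun j hj => by
      refine Finset.mem_Iio.2 (hs.lt_iff_lt.1 ?_)
      exact (Finset.mem_filter.1 hj).2.trans_lt (not_le.1 hc)
    have := Finset.card_le_card this
    simp at this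
    omega

theorem Shifted.countLE_eq {k ε : ℕ} {s s' : Fin k → ℝ} (hs : StrictMono s)
    (hs' : StrictMono s') (h : Shifted ε s s') (hε : ε ≤ 1) (τ : ℝ) :
    ε + countLE s τ = countLE s' τ ∨ ε + countLE s τ = countLE s' τ + 1 := by
  have hA := le_iff_lt_countLE hs τ
  have hB := le_iff_lt_countLE hs' τ
  have hAk := countLE_le s τ
  have hBk := countLE_le s' τ
  set A := countLE s τ
  set B := countLE s' τ
  have h1 : B ≤ ε + A := by
    by_contra hc
    have hAk' : A < k := by omega
    have h2 := (hB ⟨A + ε, by omega⟩).2 (by simp; omega)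
    have h3 : s ⟨A, hAk'⟩ ≤ s' ⟨A + ε, by omega⟩ := not_lt.1 fun hc' => by
      have := (h _ _).1 hc'
      simp at this
    have := (hA ⟨A, hAk'⟩).1 (h3.trans h2)
    simp at this
  have h2 : ε + A ≤ B + 1 := by
    by_contra hc
    have h2 := (hA ⟨A - 1, by omega⟩).2 (by simp; omega)
    have h3 := (h ⟨A - 1, by omega⟩ ⟨B, by omega⟩).2 (by simp; omega)
    have := (hB ⟨B, by omega⟩).1 (h3.le.trans h2)
    simp at this
  omega

/-- The string of `s'` carries a thick line at time `τ`, drawn from one of the points `s` above it,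
exactly when it has been entered once more than it has been left. -/
theorem Shifted.occupied_iff {k ε : ℕ} (hk : k ≠ 0) {s s' : Fin k → ℝ} (hs : StrictMono s)
    (hs' : StrictMono s') (h : Shifted ε s s') (hε : ε ≤ 1)
    (hs1 : ∀ j, s' j ∈ Ico (0 : ℝ) 1) (τ : ℝ) :
    (∃ i : Fin k, ∀ j : Fin k, s' j ∉ cyclicIcc (s i) τ) ↔
      ε + countLE s τ = countLE s' τ + 1 := by
  have hA := le_iff_lt_countLE hs τ
  have hB := le_iff_lt_countLE hs' τ
  have hAk := countLE_le s τ
  have hBk := countLE_le s' τ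
  have hAB := h.countLE_eq hs hs' hε τ
  set A := countLE s τ
  set B := countLE s' τ
  constructor
  · rintro ⟨i, hi⟩
    refine hAB.resolve_left fun hAB => ?_
    by_cases hiA : (i : ℕ) < A
    · -- the line is stopped by the first point of `s'` after `s i`
      have hsi := (hA i).2 hiA
      refine hi ⟨i + ε, by omega⟩ ?_
      rw [cyclicIcc, if_pos hsi]
      exact ⟨not_lt.1 fun hc => by simpa using (h _ _).1 hc, (hB _).2 (by simp; omega)⟩
    · have hsi : ¬ s i ≤ τ := fun hc => hiA ((hA i).1 hc)
      obtain rfl | rfl : ε = 0 ∨ ε = 1 := by omega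
      · refine hi i ?_
        rw [cyclicIcc, if_neg hsi]
        exact Or.inl ⟨not_lt.1 fun hc => by simpa using (h _ _).1 hc, (hs1 _).2⟩
      · refine hi ⟨0, by omega⟩ ?_
        rw [cyclicIcc, if_neg hsi]
        exact Or.inr ⟨(hs1 _).1, (hB _).2 (by simp; omega)⟩
  · intro hAB
    by_cases hA0 : A = 0
    · -- the line comes from the last point of `s`, around the circle
      have hB0 : B = 0 := by omega
      refine ⟨⟨k - 1, by omega⟩, fun j => ?_⟩
      have hsi : ¬ s ⟨k - 1, by omega⟩ ≤ τ := fun hc => by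
        have := (hA _).1 hc
        omega
      rw [cyclicIcc, if_neg hsi]
      rintro (hj | hj)
      · exact absurd ((h _ j).2 (by have := j.2; simp; omega)) (not_lt.2 hj.1)
      · have := (hB j).1 hj.2
        omega
    · refine ⟨⟨A - 1, by omega⟩, fun j => ?_⟩
      have hsi := (hA ⟨A - 1, by omega⟩).2 (by simp; omega)
      rw [cyclicIcc, if_pos hsi]
      intro hj
      have h1 := (hB j).1 hj.2
      exact absurd ((h ⟨A - 1, by omega⟩ j).2 (by simp; omega)) (not_lt.2 hj.1)

/-- `t` is a bead configuration whose strings occupied at time `0` are those of `O`. -/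
structure IsShiftedConfig {n k : ℕ} (O : Finset (ZMod n)) (t : ZMod n → Fin k → ℝ) : Prop where
  mem_Ico : ∀ h j, t h j ∈ Ico (0 : ℝ) 1
  strictMono : ∀ h, StrictMono (t h)
  shifted : ∀ h, Shifted (if h + 1 ∈ O then 1 else 0) (t h) (t (h + 1))

/-- The occupation number does not depend on time: the number of times a string has been entered
is the number of times the preceding string has been left. -/
theorem IsShiftedConfig.ncard_occupation {n k : ℕ} [NeZero n] (hk : k ≠ 0)
    {O : Finset (ZMod n)} {t : ZMod n → Fin k → ℝ} (ht : IsShiftedConfig O t) (τ : ℝ) :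
    (occupation t τ).ncard = O.card := by
  classical
  have key : ∀ h, (if h ∈ occupation t τ then 1 else 0) + countLE (t h) τ =
      (if h ∈ O then 1 else 0) + countLE (t (h - 1)) τ := by
    intro h
    have hsh := ht.shifted (h - 1)
    rw [sub_add_cancel] at hsh
    have hε : (if h ∈ O then 1 else 0) ≤ 1 := by split_ifs <;> simp
    have h1 := hsh.countLE_eq (ht.strictMono _) (ht.strictMono _) hε τ
    have h2 := hsh.occupied_iff hk (ht.strictMono _) (ht.strictMono _) hε (ht.mem_Ico h) τ
    change h ∈ occupation t τ ↔ _ at h2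
    by_cases h3 : h ∈ occupation t τ
    · have := h2.1 h3
      rw [if_pos h3]
      omega
    · have := h1.resolve_right (mt h2.2 h3)
      rw [if_neg h3]
      omega
  have hsum := Finset.sum_congr (rfl : (Finset.univ : Finset (ZMod n)) = _) fun h _ => key h
  have hshift : ∑ h, countLE (t (h - 1)) τ = ∑ h, countLE (t h) τ :=
    (Equiv.subRight (1 : ZMod n)).sum_comp fun h => countLE (t h) τ
  rw [Finset.sum_add_distrib, Finset.sum_add_distrib, hshift] at hsum
  have hsum' := Nat.add_right_cancel hsum
  rw [Finset.sum_boole, Finset.sum_boole] at hsum'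
  simp only [Nat.cast_id, Finset.filter_mem_eq_inter, Finset.univ_inter] at hsum'
  rw [← hsum', ← Set.ncard_coe_finset]
  congr 1
  ext
  simp

theorem mem_configs_iff {n k : ℕ} [NeZero n] (hk : k ≠ 0) (l : ℕ) (t : ZMod n → Fin k → ℝ) :
    t ∈ configs n k l ↔ ∃ O : Finset (ZMod n), O.card = l ∧ IsShiftedConfig O t := by
  classical
  constructor
  · rintro ⟨⟨h1, h2, h3⟩, h4⟩
    have hO : IsShiftedConfig (Finset.univ.filter fun h => Shifted 1 (t (h - 1)) (t h)) t := by
      refine ⟨h1, h2, fun h => ?_⟩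
      split_ifs with hc
      · simpa using hc
      · exact ((interlace_iff_shifted (h2 _) (h2 _)).1 (h3 h)).resolve_right (by simpa using hc)
    exact ⟨_, (hO.ncard_occupation hk 0).symm.trans (h4 0 (by simp)), hO⟩
  · rintro ⟨O, rfl, ht⟩
    refine ⟨⟨ht.mem_Ico, ht.strictMono, fun h => ?_⟩, fun τ _ => ht.ncard_occupation hk τ⟩
    rw [interlace_iff_shifted (ht.strictMono _) (ht.strictMono _)]
    have := ht.shifted h
    split_ifs at this
    exacts [Or.inr this, Or.inl this]

theorem measurableSet_isShiftedConfig {n k : ℕ} [NeZero n] (O : Finset (ZMod n)) :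
    MeasurableSet {t : ZMod n → Fin k → ℝ | IsShiftedConfig O t} := by
  have : {t : ZMod n → Fin k → ℝ | IsShiftedConfig O t} =
      (⋂ h, ⋂ j, {t | t h j ∈ Ico (0 : ℝ) 1}) ∩
      (⋂ h, ⋂ i, ⋂ j, {t | i < j → t h i < t h j}) ∩
      ⋂ h, ⋂ i : Fin k, ⋂ j : Fin k,
        {t | t (h + 1) j < t h i ↔ (j : ℕ) < i + (if h + 1 ∈ O then 1 else 0)} := by
    ext t
    simp only [mem_inter_iff, mem_iInter, mem_ofPred_eq]
    exact ⟨fun h => ⟨⟨h.1, fun g i j hij => h.2 g hij⟩, h.3⟩,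
      fun h => ⟨h.1.1, fun g i j hij => h.1.2 g i j hij, h.2⟩⟩
  rw [this]
  have hm : ∀ h j, Measurable fun t : ZMod n → Fin k → ℝ => t h j := fun h j => by fun_prop
  refine MeasurableSet.inter (MeasurableSet.inter ?_ ?_) ?_
  · exact .iInter fun h => .iInter fun j => hm h j measurableSet_Ico
  · refine .iInter fun h => .iInter fun i => .iInter fun j => ?_
    by_cases hij : i < j
    · simpa [hij] using measurableSet_lt (hm h i) (hm h j)
    · simp [hij]
  · refine .iInter fun h => .iInter fun i => .iInter fun j => ?_
    exact (measurableSet_lt (hm (h + 1) j) (hm h i)).iff (.const _)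

theorem measurableSet_configs {n k : ℕ} [NeZero n] (hk : k ≠ 0) (l : ℕ) :
    MeasurableSet (configs n k l) := by
  have : configs n k l = ⋃ O : Finset (ZMod n), {t | O.card = l ∧ IsShiftedConfig O t} := by
    ext t
    simp [mem_configs_iff hk]
  rw [this]
  exact .iUnion fun O => (MeasurableSet.const _).inter (measurableSet_isShiftedConfig O)

/-! ### Words of bead configurations -/

/-- The number of letters `h` of the word `w` before the position `i`. -/
def visits {n N : ℕ} (w : Fin N → ZMod n) (h : ZMod n) (i : ℕ) : ℕ :=
  (Finset.univ.filter fun i' : Fin N => (i' : ℕ) < i ∧ w i' = h).card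

/-- The word `w` lists, from left to right, the strings of the beads of a configuration with `k`
beads per string whose strings occupied at time `0` are those of `O`. -/
structure IsConfigWord {n N : ℕ} (k : ℕ) (O : Finset (ZMod n)) (w : Fin N → ZMod n) : Prop where
  total : ∀ h, visits w h N = k
  step : ∀ i : Fin N, visits w (w i + 1) i = visits w (w i) i + if w i + 1 ∈ O then 1 else 0

section visits

variable {n N : ℕ} (w : Fin N → ZMod n)

@[simp] theorem visits_zero (h : ZMod n) : visits w h 0 = 0 := by simp [visits]

theorem visits_mono (h : ZMod n) : Monotone (visits w h) := fun i j hij =>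
  Finset.card_le_card fun a => by
    simp only [Finset.mem_filter, Finset.mem_univ, true_and]
    exact fun h => ⟨h.1.trans_le hij, h.2⟩

theorem visits_succ (h : ZMod n) (i : Fin N) :
    visits w h (i + 1) = visits w h i + if w i = h then 1 else 0 := by
  unfold visits
  split_ifs with hi
  · rw [← Finset.card_insert_of_notMem (a := i) (by simp)]
    congr 1
    ext a
    simp only [Finset.mem_filter, Finset.mem_univ, true_and, Finset.mem_insert,
      Nat.lt_succ_iff_lt_or_eq, Fin.val_inj]
    grind
  · rw [add_zero]
    congr 1
    ext a
    simp only [Finset.mem_filter, Finset.mem_univ, true_and,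
      Nat.lt_succ_iff_lt_or_eq, Fin.val_inj]
    grind

theorem visits_lt_visits_iff {h : ZMod n} {i : Fin N} (hi : w i = h) (j : ℕ) :
    visits w h i < visits w h j ↔ (i : ℕ) < j := by
  constructor
  · intro hlt
    by_contra hc
    exact absurd hlt (not_lt.2 (visits_mono w h (not_lt.1 hc)))
  · intro hlt
    have := visits_mono w h (Nat.succ_le_of_lt hlt)
    rw [Nat.succ_eq_add_one, visits_succ, if_pos hi] at this
    omega

theorem visits_lt_total (i : Fin N) : visits w (w i) i < visits w (w i) N :=
  (visits_lt_visits_iff w rfl N).2 i.2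

theorem sum_visits [NeZero n] : ∑ h, visits w h N = N := by
  have := Finset.card_eq_sum_card_fiberwise (s := (Finset.univ : Finset (Fin N)))
    (t := (Finset.univ : Finset (ZMod n))) (f := w) (fun _ _ => by simp)
  simp only [Finset.card_univ, Fintype.card_fin] at this
  simpa [visits] using this.symm

/-- If the letter `h` occurs after `a` other occurrences, it does so at some position. -/
theorem exists_visits_eq {h : ZMod n} {a : ℕ} (ha : a < visits w h N) :
    ∃ i : Fin N, w i = h ∧ visits w h i = a := by
  have key : ∀ j ≤ N, a < visits w h j → ∃ i : Fin N, w i = h ∧ visits w h i = a := by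
    intro j
    induction j with
    | zero => simp
    | succ j ih =>
      intro hj hlt
      by_cases hlt' : a < visits w h j
      · exact ih (by omega) hlt'
      · rw [visits_succ w h ⟨j, by omega⟩] at hlt
        split_ifs at hlt with hw
        · exact ⟨⟨j, by omega⟩, hw, by simp at hlt ⊢; omega⟩
        · simp at hlt; omega
  exact key N le_rfl ha

variable {w}

theorem visits_eq_of_equiv {k : ℕ} {e : Fin N ≃ ZMod n × Fin k} (he : ∀ i, (e i).1 = w i)
    (h : ZMod n) (i : ℕ) :
    visits w h i = (Finset.univ.filter fun j : Fin k => (e.symm (h, j) : ℕ) < i).card := by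
  symm
  refine Finset.card_nbij' (fun j => e.symm (h, j)) (fun a => (e a).2) ?_ ?_ ?_ ?_
  · intro j hj
    simp only [Finset.coe_filter, Finset.mem_univ, true_and, Set.mem_ofPred_eq] at hj ⊢
    exact ⟨hj, by rw [← he]; simp⟩
  · intro a ha
    simp only [Finset.coe_filter, Finset.mem_univ, true_and, Set.mem_ofPred_eq] at ha ⊢
    have : (h, (e a).2) = e a := by rw [← ha.2, ← he]
    rw [this]
    simpa using ha.1
  · intro j hj
    simp
  · intro a ha
    simp only [Finset.coe_filter, Finset.mem_univ, true_and, Set.mem_ofPred_eq] at ha ⊢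
    have : (h, (e a).2) = e a := by rw [← ha.2, ← he]
    rw [this]
    simp

/-- Sort the positions of a word into strings and numbers within the string. -/
theorem exists_equiv_of_total [NeZero n] {k : ℕ} (hw : ∀ h, visits w h N = k) :
    ∃ e : Fin N ≃ ZMod n × Fin k, ∀ i, (e i).1 = w i ∧ ((e i).2 : ℕ) = visits w (w i) i := by
  have hlt : ∀ i, visits w (w i) i < k := fun i => hw (w i) ▸ visits_lt_total w i
  let f : Fin N → ZMod n × Fin k := fun i => (w i, ⟨visits w (w i) i, hlt i⟩)
  have hinj : Function.Injective f := by
    intro i j hij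
    simp only [f, Prod.mk.injEq, Fin.mk.injEq] at hij
    obtain ⟨h1, h2⟩ := hij
    rw [← h1] at h2
    have h3 := mt (visits_lt_visits_iff w (rfl : w i = w i) j).2 h2.not_lt
    have h4 := mt (visits_lt_visits_iff w h1.symm i).2 h2.not_gt
    exact Fin.ext (by omega)
  have hcard : Fintype.card (Fin N) = Fintype.card (ZMod n × Fin k) := by
    have := sum_visits w
    simp only [hw] at this
    simp at this ⊢
    exact this.symm
  exact ⟨Equiv.ofBijective f ((Fintype.bijective_iff_injective_and_card f).2 ⟨hinj, hcard⟩),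
    fun i => ⟨rfl, rfl⟩⟩

end visits

theorem isConfig_iff_isConfigWord {n N k : ℕ} [NeZero n] (hk : k ≠ 0) (l : ℕ)
    {s : Fin N → ℝ} (hs : StrictMono s) (hs1 : ∀ i, s i ∈ Ico (0 : ℝ) 1) (w : Fin N → ZMod n) :
    IsConfig k l (fun i => (s i, w i)) ↔
      ∃ O : Finset (ZMod n), O.card = l ∧ IsConfigWord k O w := by
  constructor
  · rintro ⟨t, ht, e, he⟩
    obtain ⟨O, hO, ht⟩ := (mem_configs_iff hk l t).1 ht
    simp only [Prod.mk.injEq] at he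
    have hfst : ∀ i, (e i).1 = w i := fun i => (he i).2.symm
    have hv : ∀ h (i : Fin N), visits w h i =
        (Finset.univ.filter fun j => t h j < t (e i).1 (e i).2).card := by
      intro h i
      rw [visits_eq_of_equiv hfst]
      congr 1
      ext j
      simp only [Finset.mem_filter, Finset.mem_univ, true_and, Fin.val_fin_lt]
      rw [← hs.lt_iff_lt, (he _).1, (he i).1]
      simp
    refine ⟨O, hO, ⟨fun h => ?_, fun i => ?_⟩⟩
    · rw [visits_eq_of_equiv hfst]
      simp
    · rw [hv, hv, ← hfst]
      simp only [(ht.shifted _) _ _, (ht.strictMono _).lt_iff_lt]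
      have h1 : (Finset.univ.filter fun j : Fin k =>
          (j : ℕ) < (e i).2 + if (e i).1 + 1 ∈ O then 1 else 0).card =
            (e i).2 + if (e i).1 + 1 ∈ O then 1 else 0 := by
        rw [Fin.card_filter_val_lt]
        have := (e i).2.2
        split_ifs <;> omega
      rw [h1]
      congr 1
      rw [Finset.filter_gt_eq_Iio, Fin.card_Iio]
  · rintro ⟨O, hO, hw⟩
    obtain ⟨e, he⟩ := exists_equiv_of_total hw.total
    have he1 : ∀ h j, w (e.symm (h, j)) = h := fun h j => by rw [← (he _).1]; simp
    have he2 : ∀ h j, visits w h (e.symm (h, j)) = j := fun h j => by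
      have := (he (e.symm (h, j))).2
      rw [he1] at this
      rw [← this]
      simp
    refine ⟨fun h j => s (e.symm (h, j)), (mem_configs_iff hk l _).2 ⟨O, hO,
      ⟨fun h j => hs1 _, fun h i j hij => hs ?_, fun h i j => ?_⟩⟩, e, fun i => ?_⟩
    · rw [Fin.lt_def, ← visits_lt_visits_iff w (he1 h i), he2, he2]
      exact hij
    · have := hw.step (e.symm (h, i))
      rw [he1, he2] at this
      rw [hs.lt_iff_lt, Fin.lt_def, ← visits_lt_visits_iff w (he1 (h + 1) j), he2, this]
    · ext
      · simp
      · simp [he]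

/-! ### Walks of the unoccupied strings -/

/-- A bead on the string `h` moves the thick line from `h` to `h + 1`, hence the hole, an
unoccupied string, from `h + 1` to `h`. -/
def hop {n : ℕ} (h : ZMod n) (X : Finset (ZMod n)) : Finset (ZMod n) :=
  insert h (X.erase (h + 1))

/-- There is a hole at `h + 1`, and once it is taken out there is none at `h`. The order of the two
conditions matters for `n = 1`, where the only hole may hop to its own place. -/
def CanHop {n : ℕ} (h : ZMod n) (X : Finset (ZMod n)) : Prop :=
  h + 1 ∈ X ∧ h ∉ X.erase (h + 1)

instance {n : ℕ} (h : ZMod n) (X : Finset (ZMod n)) : Decidable (CanHop h X) :=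
  inferInstanceAs (Decidable (_ ∧ _))

/-- The holes after the first `i` letters of the word `w`, which are `X` at the beginning. -/
def holes {n N : ℕ} (w : Fin N → ZMod n) (X : Finset (ZMod n)) : ℕ → Finset (ZMod n)
  | 0 => X
  | i + 1 => if hi : i < N then hop (w ⟨i, hi⟩) (holes w X i) else holes w X i

/-- The word `w` moves the holes from `X` to `Y`. -/
def IsWalk {n N : ℕ} (w : Fin N → ZMod n) (X Y : Finset (ZMod n)) : Prop :=
  (∀ i : Fin N, CanHop (w i) (holes w X i)) ∧ holes w X N = Y

instance {n N : ℕ} (w : Fin N → ZMod n) (X Y : Finset (ZMod n)) : Decidable (IsWalk w X Y) :=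
  inferInstanceAs (Decidable (_ ∧ _))

section

variable {n N : ℕ}

theorem CanHop.card_hop {h : ZMod n} {X : Finset (ZMod n)} (hX : CanHop h X) :
    (hop h X).card = X.card := by
  rw [hop, Finset.card_insert_of_notMem hX.2, Finset.card_erase_add_one hX.1]

theorem CanHop.ite_mem_hop {h : ZMod n} {X : Finset (ZMod n)} (hX : CanHop h X) (g : ZMod n) :
    (if g ∈ hop h X then 1 else 0 : ℤ) =
      (if g ∈ X then 1 else 0) - (if h = g - 1 then 1 else 0) + if h = g then 1 else 0 := by
  obtain ⟨h1, h2⟩ := hX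
  have h3 : h = g - 1 ↔ g = h + 1 := by grind
  simp only [h3, hop, Finset.mem_insert, Finset.mem_erase] at h2 ⊢
  grind

@[simp] theorem holes_zero (w : Fin N → ZMod n) (X : Finset (ZMod n)) : holes w X 0 = X := rfl

theorem holes_succ (w : Fin N → ZMod n) (X : Finset (ZMod n)) (i : Fin N) :
    holes w X (i + 1) = hop (w i) (holes w X i) := by
  rw [holes, dif_pos i.2]

/-- The holes are determined by the numbers of moves from and to each string. -/
theorem ite_mem_holes (w : Fin N → ZMod n) (X : Finset (ZMod n)) {i : ℕ} (hi : i ≤ N)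
    (hw : ∀ j : Fin N, (j : ℕ) < i → CanHop (w j) (holes w X j)) (g : ZMod n) :
    (if g ∈ holes w X i then 1 else 0 : ℤ) =
      (if g ∈ X then 1 else 0) + visits w g i - visits w (g - 1) i := by
  induction i with
  | zero =>
    change (if g ∈ X then 1 else 0 : ℤ) = _
    simp
  | succ i ih =>
    have ih' := ih (by omega) fun j hj => hw j (by omega)
    have hc := hw ⟨i, hi⟩ (by simp)
    have h1 := holes_succ w X ⟨i, hi⟩
    have h2 := fun h => visits_succ w h ⟨i, hi⟩
    simp only at h1 h2 hc
    rw [h1, h2, h2, hc.ite_mem_hop, ih']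
    push_cast
    ring

theorem eq_of_eq_sub_one [NeZero n] {f : ZMod n → ℕ} (hf : ∀ h, f h = f (h - 1)) (h : ZMod n) :
    f h = f 0 := by
  rw [← ZMod.natCast_zmod_val h]
  induction h.val with
  | zero => simp
  | succ i ih => rw [hf, ← ih]; simp

theorem IsWalk.isConfigWord [NeZero n] {w : Fin N → ZMod n} {X : Finset (ZMod n)}
    (h : IsWalk w X X) : IsConfigWord (visits w 0 N) Xᶜ w := by
  obtain ⟨h1, h2⟩ := h
  refine ⟨eq_of_eq_sub_one fun g => ?_, fun i => ?_⟩
  · have := ite_mem_holes w X le_rfl (fun j _ => h1 j) g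
    rw [h2] at this
    omega
  · have := ite_mem_holes w X i.2.le (fun j _ => h1 j) (w i + 1)
    rw [if_pos (h1 i).1, add_sub_cancel_right] at this
    simp only [Finset.mem_compl]
    split_ifs at this ⊢ <;> omega

/-- In a configuration word, the line on the string `h` is entered before it is left, and is left
before it is entered again: the interlacing of the beads of `h - 1` and `h`, read at a
bead of `h`. -/
theorem IsConfigWord.visits_sub_one {k : ℕ} {O : Finset (ZMod n)} {w : Fin N → ZMod n}
    (hw : IsConfigWord k O w) (i : Fin N) :
    (visits w (w i - 1) (i + 1) : ℤ) = visits w (w i) i + 1 - if w i ∈ O then 1 else 0 := by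
  have hstep : ∀ {i' : Fin N}, w i' = w i - 1 → visits w (w i) i' =
      visits w (w i - 1) i' + if w i ∈ O then 1 else 0 := by
    intro i' hi'
    simpa [hi'] using hw.step i'
  have hi : visits w (w i) i < k := hw.total (w i) ▸ visits_lt_total w i
  have hk : visits w (w i - 1) (i + 1) ≤ k := by
    rw [← hw.total (w i - 1)]
    exact visits_mono w _ i.2
  have hi1 := visits_succ w (w i) i
  rw [if_pos rfl] at hi1
  set a := visits w (w i - 1) (i + 1) with ha
  have h1 : a = 0 ∨ a + (if w i ∈ O then 1 else 0) ≤ visits w (w i) i + 1 := by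
    refine or_iff_not_imp_left.2 fun ha0 => ?_
    obtain ⟨i', hi', hv⟩ := exists_visits_eq w (h := w i - 1) (a := a - 1)
      (by rw [hw.total]; omega)
    have hlt := (visits_lt_visits_iff w hi' (i + 1)).1 (by omega)
    have := visits_mono w (w i) (Nat.lt_succ_iff.1 hlt)
    rw [hstep hi'] at this
    omega
  have h2 : a = k ∨ visits w (w i) i + 1 ≤ a + (if w i ∈ O then 1 else 0) := by
    refine or_iff_not_imp_left.2 fun hak => ?_
    obtain ⟨i', hi', hv⟩ := exists_visits_eq w (h := w i - 1) (a := a)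
      (by rw [hw.total]; omega)
    have hle : (i : ℕ) + 1 ≤ i' := by
      by_contra hc
      have := (visits_lt_visits_iff w hi' (i + 1)).2 (by omega)
      omega
    have := visits_mono w (w i) hle
    rw [hstep hi'] at this
    omega
  split_ifs at h1 h2 ⊢ <;> omega

theorem IsConfigWord.isWalk [NeZero n] {k : ℕ} {O : Finset (ZMod n)} {w : Fin N → ZMod n}
    (hw : IsConfigWord k O w) : IsWalk w Oᶜ Oᶜ := by
  have hcan : ∀ i : Fin N, CanHop (w i) (holes w Oᶜ i) := by
    intro i
    induction hi : (i : ℕ) using Nat.strong_induction_on generalizing i with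
    | _ m ih =>
      subst hi
      have hmem := ite_mem_holes w Oᶜ i.2.le fun j hj => ih j hj j rfl
      refine ⟨?_, fun hc => ?_⟩
      · have h1 := hmem (w i + 1)
        rw [add_sub_cancel_right, hw.step] at h1
        simp only [Finset.mem_compl] at h1
        by_contra hc
        rw [if_neg hc] at h1
        split_ifs at h1 <;> push_cast at h1 <;> omega
      · have h1 := hmem (w i)
        obtain ⟨hne, hc⟩ := Finset.mem_erase.1 hc
        have h2 := hw.visits_sub_one i
        rw [visits_succ, if_neg (fun h => hne (eq_sub_iff_add_eq.1 h).symm)] at h2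
        rw [if_pos hc] at h1
        simp only [Finset.mem_compl] at h1
        split_ifs at h1 h2 <;> push_cast at h2 <;> omega
  refine ⟨hcan, ?_⟩
  ext g
  have := ite_mem_holes w Oᶜ le_rfl (fun j _ => hcan j) g
  rw [hw.total, hw.total] at this
  split_ifs at this <;> first | omega | tauto

/-- The strings occupied at time `0` are determined by the word, unless it is empty. -/
theorem IsConfigWord.unique {k k' : ℕ} (hk : k ≠ 0) {O O' : Finset (ZMod n)}
    {w : Fin N → ZMod n} (hw : IsConfigWord k O w) (hw' : IsConfigWord k' O' w) : O = O' := by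
  ext g
  obtain ⟨i, hi, -⟩ := exists_visits_eq w (h := g - 1) (a := 0) (by rw [hw.total]; omega)
  have h1 := hw.step i
  have h2 := hw'.step i
  rw [hi, sub_add_cancel] at h1 h2
  split_ifs at h1 h2 <;> first | omega | tauto

theorem holes_snoc (w : Fin N → ZMod n) (h : ZMod n) (X : Finset (ZMod n)) {i : ℕ} (hi : i ≤ N) :
    holes (Fin.snoc w h : Fin (N + 1) → ZMod n) X i = holes w X i := by
  induction i with
  | zero => rfl
  | succ i ih =>
    have h1 := holes_succ (Fin.snoc w h : Fin (N + 1) → ZMod n) X (Fin.castSucc ⟨i, hi⟩)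
    have h2 := holes_succ w X ⟨i, hi⟩
    rw [Fin.snoc_castSucc] at h1
    simp only [Fin.val_castSucc] at h1 h2
    rw [h1, h2, ih (by omega)]

theorem isWalk_snoc (w : Fin N → ZMod n) (h : ZMod n) (X Y : Finset (ZMod n)) :
    IsWalk (Fin.snoc w h : Fin (N + 1) → ZMod n) X Y ↔
      ∃ Z, IsWalk w X Z ∧ CanHop h Z ∧ hop h Z = Y := by
  have h1 : holes (Fin.snoc w h : Fin (N + 1) → ZMod n) X (N + 1) = hop h (holes w X N) := by
    have := holes_succ (Fin.snoc w h : Fin (N + 1) → ZMod n) X (Fin.last N)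
    rw [Fin.snoc_last] at this
    simpa [holes_snoc] using this
  unfold IsWalk
  rw [h1, Fin.forall_fin_succ']
  simp only [Fin.snoc_castSucc, Fin.snoc_last, Fin.val_castSucc, Fin.val_last,
    holes_snoc w h X le_rfl, holes_snoc w h X (Fin.is_lt _).le]
  constructor
  · rintro ⟨⟨h1, h2⟩, h3⟩
    exact ⟨_, ⟨h1, rfl⟩, h2, h3⟩
  · rintro ⟨_, ⟨h1, rfl⟩, h2, h3⟩
    exact ⟨⟨h1, h2⟩, h3⟩

theorem IsWalk.card_eq {w : Fin N → ZMod n} {X Y : Finset (ZMod n)} (h : IsWalk w X Y) :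
    Y.card = X.card := by
  obtain ⟨h1, rfl⟩ := h
  have : ∀ i ≤ N, (holes w X i).card = X.card := by
    intro i
    induction i with
    | zero => simp
    | succ i ih =>
      intro hi
      rw [holes_succ w X ⟨i, hi⟩, (h1 ⟨i, hi⟩).card_hop, ih (by omega)]
  exact this N le_rfl

/-- The transfer matrix of `m` holes: the entry at `(X, Y)` is the number of hops from `X`
to `Y`. -/
def hopMatrix (n m : ℕ) [NeZero n] :
    Matrix (powersetCard (ZMod n) m) (powersetCard (ZMod n) m) ℂ :=
  Matrix.of fun X Y => ∑ h : ZMod n, if CanHop h X.1 ∧ hop h X.1 = Y.1 then 1 else 0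

theorem hopMatrix_pow_apply [NeZero n] (m N : ℕ) (X Y : powersetCard (ZMod n) m) :
    (hopMatrix n m ^ N) X Y = ∑ w : Fin N → ZMod n, if IsWalk w X.1 Y.1 then 1 else 0 := by
  induction N generalizing Y with
  | zero => simp [IsWalk, Matrix.one_apply, Subtype.ext_iff]
  | succ N ih =>
    rw [pow_succ, Matrix.mul_apply, ← (Fin.snocEquiv fun _ => ZMod n).sum_comp,
      Fintype.sum_prod_type_right]
    simp only [ih]
    simp only [hopMatrix, Matrix.of_apply, Finset.sum_mul_sum]
    rw [Finset.sum_comm]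
    refine Finset.sum_congr rfl fun w _ => ?_
    rw [Finset.sum_comm]
    refine Finset.sum_congr rfl fun h _ => ?_
    change _ = if IsWalk (Fin.snoc w h : Fin (N + 1) → ZMod n) X.1 Y.1 then (1 : ℂ) else 0
    by_cases hw : ∃ Z, IsWalk w X.1 Z ∧ CanHop h Z ∧ hop h Z = Y.1
    · rw [if_pos ((isWalk_snoc w h _ _).2 hw)]
      obtain ⟨Z, h1, h2⟩ := hw
      rw [Finset.sum_eq_single (⟨Z, h1.card_eq.trans X.2⟩ : powersetCard (ZMod n) m)]
      · rw [if_pos h1, if_pos h2, one_mul]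
      · intro Z' _ hZ'
        rw [if_neg (fun h3 : IsWalk w X.1 Z'.1 => hZ' (Subtype.ext (h3.2.symm.trans h1.2))),
          zero_mul]
      · simp
    · rw [if_neg (mt (isWalk_snoc w h _ _).1 hw)]
      refine Finset.sum_eq_zero fun Z _ => ?_
      rw [ite_mul, one_mul, zero_mul, ← ite_and, if_neg]
      exact fun h => hw ⟨Z, h⟩

end

/-! ### Determinants -/

section CauchyBinet

variable {α : Type*} {m : ℕ}

/-- Some enumeration of the elements of an `m`-element set. -/
noncomputable def enum (X : powersetCard α m) : Fin m → α :=
  fun i => ((X.1.equivFinOfCardEq X.2).symm i : α)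

theorem enum_injective (X : powersetCard α m) : Function.Injective (enum X) :=
  Subtype.val_injective.comp (Equiv.injective _)

theorem mem_iff_exists_enum (X : powersetCard α m) {a : α} : a ∈ X.1 ↔ ∃ i, enum X i = a := by
  constructor
  · intro ha
    exact ⟨X.1.equivFinOfCardEq X.2 ⟨a, ha⟩, by simp [enum]⟩
  · rintro ⟨i, rfl⟩
    exact Subtype.prop _

theorem enum_mem (X : powersetCard α m) (i : Fin m) : enum X i ∈ X.1 :=
  (mem_iff_exists_enum X).2 ⟨i, rfl⟩

theorem exists_perm_enum {x : Fin m → α} (hx : Function.Injective x) (X : powersetCard α m)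
    (hX : ∀ i, x i ∈ X.1) : ∃ τ : Equiv.Perm (Fin m), x = enum X ∘ τ := by
  choose τ hτ using fun i => (mem_iff_exists_enum X).1 (hX i)
  have hinj : Function.Injective τ := fun i j hij => hx (by rw [← hτ, ← hτ, hij])
  exact ⟨Equiv.ofBijective τ (Finite.injective_iff_bijective.1 hinj),
    funext fun i => (hτ i).symm⟩

theorem sum_image_enum {M : Type*} [AddCommMonoid M] (X : powersetCard α m) (f : α → M) :
    ∑ a ∈ X.1, f a = ∑ i, f (enum X i) := by
  rw [← Finset.sum_coe_sort, ← (X.1.equivFinOfCardEq X.2).symm.sum_comp]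
  rfl

/-- An injective tuple is an enumeration of a set, composed with a permutation. -/
theorem sum_injective_eq_sum_sum [Fintype α] [DecidableEq α] {M : Type*} [AddCommMonoid M]
    (f : (Fin m → α) → M) (hf : ∀ x, ¬ Function.Injective x → f x = 0) :
    ∑ x, f x = ∑ X : powersetCard α m, ∑ τ : Equiv.Perm (Fin m), f (enum X ∘ τ) := by
  classical
  rw [← Finset.sum_filter_of_ne (p := Function.Injective)
    fun x _ hx => not_not.1 (mt (hf x) hx), ← Fintype.sum_prod_type']
  symm
  refine Finset.sum_bij (fun p _ => enum p.1 ∘ p.2) ?_ ?_ ?_ ?_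
  · intro p _
    simpa using (enum_injective p.1).comp p.2.injective
  · rintro ⟨X, τ⟩ _ ⟨Y, σ⟩ _ h
    simp only at h
    have hXY : X = Y := by
      ext a
      rw [mem_iff_exists_enum, mem_iff_exists_enum,
        ← τ.exists_congr_right (q := fun i => enum X i = a),
        ← σ.exists_congr_right (q := fun i => enum Y i = a)]
      exact exists_congr fun i => by rw [show enum X (τ i) = enum Y (σ i) from congrFun h i]
    subst hXY
    rw [Prod.mk.injEq]
    exact ⟨rfl, Equiv.ext fun i => enum_injective X (congrFun h i)⟩
  · intro x hx
    have hx : Function.Injective x := by simpa using hx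
    let X : powersetCard α m := ⟨Finset.univ.image x, by
      change (Finset.univ.image x).card = m
      rw [Finset.card_image_of_injective _ hx, Finset.card_univ, Fintype.card_fin]⟩
    obtain ⟨τ, hτ⟩ := exists_perm_enum hx X fun i => by simp [X]
    exact ⟨(X, τ), by simp, hτ.symm⟩
  · intro p _
    rfl

/-- The Cauchy–Binet formula. -/
theorem det_mul_eq_sum_det_mul_det [Fintype α] [DecidableEq α] {R : Type*} [CommRing R]
    (A : Matrix (Fin m) α R) (B : Matrix α (Fin m) R) :
    (A * B).det = ∑ X : powersetCard α m,
      (A.submatrix id (enum X)).det * (B.submatrix (enum X) id).det := by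
  have h1 : (A * B).det = ∑ x : Fin m → α, (A.submatrix id x).det * ∏ i, B (x i) i := by
    simp only [Matrix.det_apply', Matrix.mul_apply, Finset.prod_univ_sum, Fintype.piFinset_univ,
      Finset.mul_sum, Finset.sum_mul, Matrix.submatrix_apply, id]
    rw [Finset.sum_comm]
    simp only [Finset.prod_mul_distrib, mul_assoc]
  rw [h1, sum_injective_eq_sum_sum]
  · refine Finset.sum_congr rfl fun X _ => ?_
    rw [Matrix.det_apply' (B.submatrix (enum X) id), Finset.mul_sum]
    refine Finset.sum_congr rfl fun τ _ => ?_
    have : A.submatrix id (enum X ∘ τ) = (A.submatrix id (enum X)).submatrix id τ := by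
      simp [Matrix.submatrix_submatrix]
    rw [this, Matrix.det_permute']
    simp only [Function.comp_apply, Matrix.submatrix_apply, id]
    ring
  · intro x hx
    obtain ⟨i, j, hij, hne⟩ : ∃ i j, x i = x j ∧ i ≠ j := by
      simpa [Function.Injective] using hx
    rw [Matrix.det_zero_of_column_eq hne (by simp [hij]), zero_mul]

/-- Multiplying the columns of a matrix in turn by the same vector. -/
theorem sum_det_mul_column {R : Type*} [CommRing R] (M : Matrix (Fin m) (Fin m) R)
    (d : Fin m → R) :
    ∑ j, (Matrix.of fun i l => M i l * if l = j then d i else 1).det = (∑ i, d i) * M.det := by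
  simp only [Matrix.det_apply', Matrix.of_apply, Finset.prod_mul_distrib, Finset.mul_sum]
  rw [Finset.sum_comm]
  refine Finset.sum_congr rfl fun σ _ => ?_
  simp only [Finset.prod_ite_eq', Finset.mem_univ, if_true]
  rw [← Finset.mul_sum, ← Finset.mul_sum, Equiv.sum_comp σ d]
  ring

end CauchyBinet

/-! ### Eigenvectors of the transfer matrix -/

section Slater

variable {n m : ℕ}

/-- The sign of the permutation that sorts the tuple `x` by representatives in `[0, n)`, or `0` if
two entries of `x` agree. -/
noncomputable def orderSign (x : Fin m → ZMod n) : ℂ :=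
  ∏ i, ∏ j > i, ((SignType.sign (((x j).val : ℤ) - (x i).val) : ℤ) : ℂ)

/-- The Slater determinant of the plane waves `u i ^ x`, made symmetric in the entries of `x`. -/
noncomputable def slater (u : Fin m → ℂ) (x : Fin m → ZMod n) : ℂ :=
  orderSign x * (Matrix.of fun i j => u i ^ (x j).val).det

theorem orderSign_comp (x : Fin m → ZMod n) (τ : Equiv.Perm (Fin m)) :
    orderSign (x ∘ τ) = Equiv.Perm.sign τ * orderSign x := by
  refine Equiv.Perm.prod_Ioi_comp_eq_sign_mul_prod τ
    (f := fun i j => ((SignType.sign (((x j).val : ℤ) - (x i).val) : ℤ) : ℂ)) fun i j => ?_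
  rw [← neg_sub, Left.sign_neg]
  simp

theorem orderSign_mul_self [NeZero n] {x : Fin m → ZMod n} (hx : Function.Injective x) :
    orderSign x * orderSign x = 1 := by
  simp only [orderSign, ← Finset.prod_mul_distrib]
  refine Finset.prod_eq_one fun i _ => Finset.prod_eq_one fun j hj => ?_
  have hne : ((x j).val : ℤ) - (x i).val ≠ 0 := fun h =>
    (Finset.mem_Ioi.1 hj).ne' (hx (ZMod.val_injective n (by omega)))
  rcases lt_or_gt_of_ne hne with h | h
  · rw [sign_neg h]
    simp
  · rw [sign_pos h]
    simp

theorem slater_comp (u : Fin m → ℂ) (x : Fin m → ZMod n) (τ : Equiv.Perm (Fin m)) :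
    slater u (x ∘ τ) = slater u x := by
  have : (Matrix.of fun i j => u i ^ ((x ∘ τ) j).val) =
      (Matrix.of fun i j => u i ^ (x j).val).submatrix id τ := rfl
  rw [slater, slater, this, orderSign_comp, Matrix.det_permute']
  have h : (Equiv.Perm.sign τ : ℂ) * (Equiv.Perm.sign τ : ℂ) = 1 := by
    rcases Int.units_eq_one_or (Equiv.Perm.sign τ) with h | h <;> simp [h]
  linear_combination orderSign x * (Matrix.of fun i j => u i ^ (x j).val).det * h

theorem det_pow_val_eq_zero (u : Fin m → ℂ) {x : Fin m → ZMod n} (hx : ¬ Function.Injective x) :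
    (Matrix.of fun i j => u i ^ (x j).val).det = 0 := by
  obtain ⟨i, j, hij, hne⟩ : ∃ i j, x i = x j ∧ i ≠ j := by
    simpa [Function.Injective] using hx
  exact Matrix.det_zero_of_column_eq hne (by simp [hij])

theorem slater_eq_zero (u : Fin m → ℂ) {x : Fin m → ZMod n} (hx : ¬ Function.Injective x) :
    slater u x = 0 := by
  rw [slater, det_pow_val_eq_zero u hx, mul_zero]

theorem val_sub_one_add_one [NeZero n] {a : ZMod n} (ha : a ≠ 0) :
    (a - 1).val + 1 = a.val := by
  have h0 : a.val ≠ 0 := fun h => ha ((ZMod.val_eq_zero a).1 h)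
  have h1 : a - 1 = ((a.val - 1 : ℕ) : ZMod n) := by
    rw [Nat.cast_sub (by omega), ZMod.natCast_zmod_val, Nat.cast_one]
  rw [h1, ZMod.val_natCast_of_lt (by have := a.val_lt; omega)]
  omega

theorem val_zero_sub_one_add_one [NeZero n] : ((0 : ZMod n) - 1).val + 1 = n := by
  obtain ⟨k, rfl⟩ : ∃ k, n = k + 1 := ⟨n - 1, by have := NeZero.ne n; omega⟩
  rw [zero_sub, ZMod.val_neg_one]

/-- The sign of the cyclic permutation that takes the entry `x j` through all others. -/
theorem prod_neg_one_pairs (j : Fin m) :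
    ∏ a : Fin m, ∏ b > a, (if a = j ∨ b = j then (-1 : ℂ) else 1) = (-1) ^ (m - 1) := by
  have h1 : ∀ a : Fin m, ∏ b > a, (if a = j ∨ b = j then (-1 : ℂ) else 1) =
      (if a = j then (-1) ^ (m - 1 - (a : ℕ)) else 1) * if a < j then -1 else 1 := by
    intro a
    by_cases ha : a = j
    · simp [ha]
    · simp [ha, Finset.prod_ite_eq', Finset.mem_Ioi]
  simp only [h1, Finset.prod_mul_distrib, Finset.prod_ite_eq', Finset.mem_univ, if_true]
  rw [Finset.prod_ite, Finset.prod_const, Finset.prod_const_one, mul_one,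
    Finset.filter_gt_eq_Iio, Fin.card_Iio, ← pow_add]
  congr 1
  have := j.2
  omega

/-- Moving one entry of an injective tuple one step to the left multiplies the corresponding column
of the Slater determinant by `u⁻¹`. When the entry wraps around from `0` to `n - 1`, the factor
`u ^ n = (-1) ^ (m + 1)` is made up for by the `m - 1` entries that it has overtaken. -/
theorem slater_update [NeZero n] {u : Fin m → ℂ} (hu : ∀ i, u i ^ n = (-1) ^ (m + 1))
    {x : Fin m → ZMod n} (hx : Function.Injective x) (j : Fin m) :
    slater u (Function.update x j (x j - 1)) = orderSign x *
      (Matrix.of fun i l => u i ^ (x l).val * if l = j then (u i)⁻¹ else 1).det := by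
  have hu0 : ∀ i, u i ≠ 0 := fun i h => by
    have := hu i
    rw [h, zero_pow (NeZero.ne n)] at this
    exact pow_ne_zero _ (by norm_num) this.symm
  set y := Function.update x j (x j - 1) with hy
  have hyj : y j = x j - 1 := by simp [hy]
  have hyl : ∀ l, l ≠ j → y l = x l := fun l hl => by simp [hy, hl]
  -- the factor produced by the wrap-around
  set η : ℂ := if x j = 0 then (-1) ^ (m + 1) else 1 with hη
  have hη2 : η * η = 1 := by
    rw [hη]
    split_ifs
    · rw [← pow_add]
      exact Even.neg_one_pow ⟨_, rfl⟩
    · simp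
  have hdet : (Matrix.of fun i l => u i ^ (y l).val).det = η *
      (Matrix.of fun i l => u i ^ (x l).val * if l = j then (u i)⁻¹ else 1).det := by
    have h1 : (Matrix.of fun i l => u i ^ (y l).val) = Matrix.of fun i l =>
        (if l = j then η else 1) *
          (Matrix.of fun i l => u i ^ (x l).val * if l = j then (u i)⁻¹ else 1) i l := by
      ext i l
      simp only [Matrix.of_apply]
      by_cases hl : l = j
      · subst hl
        rw [if_pos rfl, if_pos rfl, hyj, hη]
        apply mul_right_cancel₀ (hu0 i)
        rw [← pow_succ]
        split_ifs with h0
        · rw [h0, val_zero_sub_one_add_one, hu]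
          simp [hu0]
        · rw [val_sub_one_add_one h0]
          simp [hu0]
      · simp [hl, hyl l hl]
    rw [h1, Matrix.det_mul_row]
    simp
  by_cases hinj : Function.Injective y
  · have hsign : orderSign y = η * orderSign x := by
      have h1 : ∀ a b : Fin m, a ≠ b →
          ((SignType.sign (((y b).val : ℤ) - (y a).val) : ℤ) : ℂ) =
          (if a = j ∨ b = j then (if x j = 0 then -1 else 1) else 1) *
          ((SignType.sign (((x b).val : ℤ) - (x a).val) : ℤ) : ℂ) := by
        -- the relative order of `x l` and `x j`
        have key : ∀ l, l ≠ j → (SignType.sign (((y l).val : ℤ) - (y j).val) : ℤ) =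
            (if x j = 0 then -1 else 1) * SignType.sign (((x l).val : ℤ) - (x j).val) := by
          intro l hl
          have hne1 : (x l).val ≠ (x j).val := fun h => hl (hx (ZMod.val_injective n h))
          have hne2 : (x l).val ≠ (x j - 1).val := fun h =>
            hl (hinj (by rw [hyj, hyl l hl]; exact ZMod.val_injective n h))
          rw [hyj, hyl l hl]
          split_ifs with h0
          · have h2 := val_zero_sub_one_add_one (n := n)
            have h3 := (x l).val_lt
            rw [h0] at hne1 hne2 ⊢
            rw [ZMod.val_zero] at hne1 ⊢
            rw [sign_neg (by omega), sign_pos (by omega)]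
            simp
          · have h2 := val_sub_one_add_one h0
            rw [one_mul]
            rcases lt_or_gt_of_ne hne1 with h | h
            · rw [sign_neg (by omega), sign_neg (by omega)]
            · rw [sign_pos (by omega), sign_pos (by omega)]
        intro a b hab
        by_cases hb : b = j
        · subst hb
          rw [if_pos (Or.inr rfl), ← neg_sub ((y a).val : ℤ), Left.sign_neg, SignType.coe_neg,
            key a hab, ← neg_sub ((x a).val : ℤ), Left.sign_neg, SignType.coe_neg]
          push_cast
          ring
        · by_cases ha : a = j
          · subst ha
            rw [if_pos (Or.inl rfl), key b hb]
            push_cast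
            ring
          · rw [if_neg (by tauto), hyl a ha, hyl b hb, one_mul]
      have h2 : orderSign y = (∏ a : Fin m, ∏ b > a,
          (if a = j ∨ b = j then (if x j = 0 then (-1 : ℂ) else 1) else 1)) * orderSign x := by
        simp only [orderSign, ← Finset.prod_mul_distrib]
        exact Finset.prod_congr rfl fun a _ => Finset.prod_congr rfl fun b hb =>
          h1 a b (Finset.mem_Ioi.1 hb).ne
      rw [h2, hη]
      congr 1
      split_ifs
      · rw [prod_neg_one_pairs]
        have hm := j.2
        obtain ⟨k, rfl⟩ : ∃ k, m = k + 1 := ⟨m - 1, by omega⟩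
        simp [pow_succ]
      · simp
    rw [slater, hsign, hdet]
    linear_combination orderSign x *
      (Matrix.of fun i l => u i ^ (x l).val * if l = j then (u i)⁻¹ else 1).det * hη2
  · rw [slater_eq_zero u hinj]
    have h0 := det_pow_val_eq_zero u hinj
    rw [hdet] at h0
    have : η ≠ 0 := fun h => by simp [h] at hη2
    rw [(mul_eq_zero.1 h0).resolve_left this, mul_zero]

theorem sum_slater_update [NeZero n] {u : Fin m → ℂ} (hu : ∀ i, u i ^ n = (-1) ^ (m + 1))
    {x : Fin m → ZMod n} (hx : Function.Injective x) :
    ∑ j, slater u (Function.update x j (x j - 1)) = (∑ i, (u i)⁻¹) * slater u x := by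
  simp only [slater_update hu hx]
  rw [← Finset.mul_sum, slater]
  have := sum_det_mul_column (Matrix.of fun i l => u i ^ (x l).val) fun i => (u i)⁻¹
  simp only [Matrix.of_apply] at this
  rw [this]
  ring

end Slater

/-! ### The trace of the transfer matrix -/

section trace

variable {n m : ℕ}

theorem sum_powersetCard_coe (R : Finset ℂ) (m : ℕ) (f : ℂ → ℂ) :
    ∑ W : powersetCard R m, f (∑ w ∈ W.1, (w : ℂ)) = ∑ W ∈ R.powersetCard m, f (∑ w ∈ W, w) := by
  conv_rhs => rw [← Finset.attach_map_val (s := R), Finset.powersetCard_map, Finset.sum_map]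
  have h := Finset.sum_subtype (F := inferInstanceAs (Fintype (powersetCard R m))) (p := fun W => W ∈ powersetCard R m) (R.attach.powersetCard m)
    (fun W => by
      rw [Finset.mem_powersetCard, powersetCard.mem_iff]
      exact ⟨fun h => h.2, fun h => ⟨fun x _ => Finset.mem_attach _ x, h⟩⟩)
    (fun W : Finset R => f (∑ w ∈ W, (w : ℂ)))
  refine Eq.trans ?_ (h.symm.trans (Finset.sum_congr rfl fun W _ => ?_))
  · rfl
  · congr 1
    exact (Finset.sum_map W (Function.Embedding.subtype _) fun w => w).symm

theorem slater_enum (u : Fin m → ℂ) {x : Fin m → ZMod n} (hx : Function.Injective x)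
    (X : powersetCard (ZMod n) m) (hX : ∀ i, x i ∈ X.1) : slater u (enum X) = slater u x := by
  obtain ⟨τ, rfl⟩ := exists_perm_enum hx X hX
  rw [slater_comp]

variable [NeZero n]

/-- The Slater determinants are eigenvectors: the hops that are not allowed contribute determinants
with two equal columns. -/
theorem sum_hopMatrix_mul_slater {u : Fin m → ℂ} (hu : ∀ i, u i ^ n = (-1) ^ (m + 1))
    (X : powersetCard (ZMod n) m) :
    ∑ Y, hopMatrix n m X Y * slater u (enum Y) = (∑ i, (u i)⁻¹) * slater u (enum X) := by
  have h1 : ∀ g : ZMod n, ∑ Y : powersetCard (ZMod n) m,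
      (if CanHop (g - 1) X.1 ∧ hop (g - 1) X.1 = Y.1 then 1 else 0) * slater u (enum Y) =
      if hg : CanHop (g - 1) X.1 then
        slater u (enum (⟨hop (g - 1) X.1, hg.card_hop.trans X.2⟩ : powersetCard (ZMod n) m))
      else 0 := by
    intro g
    split_ifs with hg
    · rw [Finset.sum_eq_single
        (⟨hop (g - 1) X.1, hg.card_hop.trans X.2⟩ : powersetCard (ZMod n) m)]
      · simp [hg]
      · intro Y _ hY
        rw [if_neg, zero_mul]
        exact fun h => hY (Subtype.ext h.2.symm)
      · simp
    · simp [hg]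
  rw [← sum_slater_update hu (enum_injective X)]
  simp only [hopMatrix, Matrix.of_apply, Finset.sum_mul]
  rw [Finset.sum_comm, ← (Equiv.subRight (1 : ZMod n)).sum_comp]
  simp only [Equiv.subRight_apply, h1]
  rw [← Finset.sum_subset (Finset.subset_univ X.1), sum_image_enum X]
  · refine Finset.sum_congr rfl fun j _ => ?_
    split_ifs with hg
    · obtain ⟨hg1, hg2⟩ := hg
      rw [sub_add_cancel] at hg2
      have hne : ∀ l, l ≠ j → enum X l ≠ enum X j - 1 := fun l hl hc =>
        hg2 (Finset.mem_erase.2 ⟨hc ▸ fun h => hl (enum_injective X h), hc ▸ enum_mem X l⟩)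
      refine slater_enum u ?_ _ fun i => ?_
      · intro a b hab
        by_cases ha : a = j <;> by_cases hb : b = j
        · rw [ha, hb]
        · subst ha
          rw [Function.update_self, Function.update_of_ne hb] at hab
          exact absurd hab.symm (hne b hb)
        · subst hb
          rw [Function.update_self, Function.update_of_ne ha] at hab
          exact absurd hab (hne a ha)
        · rw [Function.update_of_ne ha, Function.update_of_ne hb] at hab
          exact enum_injective X hab
      · simp only [hop, sub_add_cancel, Finset.mem_insert, Finset.mem_erase]
        by_cases hi : i = j
        · subst hi
          simp
        · rw [Function.update_of_ne hi]
          exact Or.inr ⟨fun h => hi (enum_injective X h), enum_mem X i⟩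
    · refine (slater_eq_zero u fun hinj => hg ⟨?_, fun hc => ?_⟩).symm
      · simpa using enum_mem X j
      · rw [sub_add_cancel, Finset.mem_erase] at hc
        obtain ⟨l, hl⟩ := (mem_iff_exists_enum X).1 hc.2
        have hlj : l ≠ j := fun h => hc.1 (h ▸ hl).symm
        refine hlj (hinj ?_)
        rw [Function.update_self, Function.update_of_ne hlj, hl]
  · intro g _ hg
    rw [dif_neg]
    exact fun h => hg (by simpa using h.1)

theorem card_nthRootsFinset_neg_one_pow (j : ℕ) :
    (Polynomial.nthRootsFinset n ((-1 : ℂ) ^ j)).card = n := by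
  have hζ := Complex.isPrimitiveRoot_exp n (NeZero.ne n)
  rw [Polynomial.nthRootsFinset, Multiset.toFinset_card_of_nodup
    (hζ.nthRoots_nodup (pow_ne_zero _ (by norm_num))), hζ.card_nthRoots, if_pos]
  exact IsAlgClosed.exists_pow_nat_eq _ (Nat.pos_of_ne_zero (NeZero.ne n))

theorem sum_pow_val_of_pow_eq_one {z : ℂ} (hz : z ^ n = 1) :
    ∑ y : ZMod n, z ^ y.val = if z = 1 then (n : ℂ) else 0 := by
  have h1 : ∑ y : ZMod n, z ^ y.val = ∑ i ∈ Finset.range n, z ^ i := by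
    obtain ⟨k, rfl⟩ : ∃ k, n = k + 1 := ⟨n - 1, by have := NeZero.ne n; omega⟩
    exact Fin.sum_univ_eq_sum_range (fun i => z ^ i) (k + 1)
  rw [h1]
  split_ifs with h
  · simp [h]
  · rw [geom_sum_eq h, hz, sub_self, zero_div]

/-- The transfer matrix is diagonalized by the Slater determinants of the `n`-th roots of
`(-1) ^ (m + 1)`. They form an invertible matrix by the Cauchy–Binet formula and the
orthogonality of plane waves. -/
theorem trace_hopMatrix_pow (N : ℕ) :
    (hopMatrix n m ^ N).trace =
      ∑ W ∈ (Polynomial.nthRootsFinset n ((-1 : ℂ) ^ (m + 1))).powersetCard m,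
        (∑ w ∈ W, w) ^ N := by
  classical
  set R := Polynomial.nthRootsFinset n ((-1 : ℂ) ^ (m + 1)) with hR
  have hn : 0 < n := Nat.pos_of_ne_zero (NeZero.ne n)
  have hroot : ∀ w : R, (w : ℂ) ^ n = (-1) ^ (m + 1) := fun w =>
    (Polynomial.mem_nthRootsFinset hn _).1 w.2
  have hne : ∀ w : R, (w : ℂ) ≠ 0 := fun w h => by
    have := hroot w
    rw [h, zero_pow hn.ne'] at this
    exact pow_ne_zero _ (by norm_num) this.symm
  have hsq : ((-1 : ℂ) ^ (m + 1))⁻¹ = (-1) ^ (m + 1) := by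
    rw [← inv_pow]
    norm_num
  let v : powersetCard R m → Fin m → ℂ := fun W i => ((enum W i : R) : ℂ)
  let A : Matrix (powersetCard (ZMod n) m) (powersetCard R m) ℂ :=
    Matrix.of fun X W => slater (fun i => (v W i)⁻¹) (enum X)
  let B : Matrix (powersetCard R m) (powersetCard (ZMod n) m) ℂ :=
    Matrix.of fun W X => ((n : ℂ) ^ m)⁻¹ * slater (v W) (enum X)
  let D : powersetCard R m → ℂ := fun W => ∑ i, v W i
  have hHA : hopMatrix n m * A = A * Matrix.diagonal D := by
    ext X W
    rw [Matrix.mul_apply, Matrix.mul_diagonal]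
    simp only [A, Matrix.of_apply]
    rw [sum_hopMatrix_mul_slater, mul_comm]
    · simp [D]
    · intro i
      rw [inv_pow, hroot, hsq]
  have hBA : B * A = 1 := by
    ext W W'
    have h1 : (B * A) W W' = ((n : ℂ) ^ m)⁻¹ *
        (Matrix.of (fun (i : Fin m) (y : ZMod n) => v W i ^ y.val) *
          Matrix.of fun (y : ZMod n) (j : Fin m) => (v W' j)⁻¹ ^ y.val).det := by
      rw [det_mul_eq_sum_det_mul_det, Matrix.mul_apply, Finset.mul_sum]
      refine Finset.sum_congr rfl fun X _ => ?_
      simp only [A, B, Matrix.of_apply, slater]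
      have h2 : (Matrix.of fun (y : ZMod n) (j : Fin m) => (v W' j)⁻¹ ^ y.val).submatrix
          (enum X) id = (Matrix.of fun i j => (v W' i)⁻¹ ^ (enum X j).val).transpose := rfl
      have h3 : (Matrix.of (fun (i : Fin m) (y : ZMod n) => v W i ^ y.val)).submatrix
          id (enum X) = Matrix.of fun i j => v W i ^ (enum X j).val := rfl
      rw [h2, h3, Matrix.det_transpose]
      linear_combination ((n : ℂ) ^ m)⁻¹ * (Matrix.of fun i j => v W i ^ (enum X j).val).det *
        (Matrix.of fun i j => (v W' i)⁻¹ ^ (enum X j).val).det *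
        orderSign_mul_self (enum_injective X)
    have h4 : (Matrix.of (fun (i : Fin m) (y : ZMod n) => v W i ^ y.val) *
          Matrix.of fun (y : ZMod n) (j : Fin m) => (v W' j)⁻¹ ^ y.val) =
        Matrix.of fun i j => if enum W i = enum W' j then (n : ℂ) else 0 := by
      ext i j
      rw [Matrix.mul_apply]
      simp only [Matrix.of_apply, ← mul_pow]
      rw [sum_pow_val_of_pow_eq_one]
      · refine if_congr ?_ rfl rfl
        rw [mul_inv_eq_one₀ (hne _), Subtype.ext_iff]
      · rw [mul_pow, inv_pow, hroot, hroot, mul_inv_cancel₀ (pow_ne_zero _ (by norm_num))]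
    rw [h1, h4]
    by_cases hW : W = W'
    · subst hW
      have h5 : (Matrix.of fun i j => if enum W i = enum W j then (n : ℂ) else 0) =
          Matrix.diagonal fun _ => (n : ℂ) := by
        ext i j
        simp [Matrix.diagonal_apply, (enum_injective W).eq_iff]
      rw [h5, Matrix.det_diagonal, Matrix.one_apply_eq, Finset.prod_const, Finset.card_univ,
        Fintype.card_fin, inv_mul_cancel₀]
      exact pow_ne_zero _ (Nat.cast_ne_zero.2 hn.ne')
    · rw [Matrix.one_apply_ne hW]
      obtain ⟨i, hi⟩ : ∃ i, ∀ j, enum W i ≠ enum W' j := by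
        by_contra! hc
        refine hW (Subtype.ext (Finset.eq_of_subset_of_card_le (fun a ha => ?_)
          (by rw [powersetCard.card_eq, powersetCard.card_eq])))
        obtain ⟨i, rfl⟩ := (mem_iff_exists_enum W).1 ha
        obtain ⟨j, hj⟩ := hc i
        exact hj ▸ enum_mem W' j
      rw [Matrix.det_eq_zero_of_row_eq_zero i (by simp [hi]), mul_zero]
  have hcard : Fintype.card (powersetCard (ZMod n) m) = Fintype.card (powersetCard R m) := by
    rw [← Nat.card_eq_fintype_card, ← Nat.card_eq_fintype_card, powersetCard.card,
      powersetCard.card]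
    congr 1
    rw [Nat.card_zmod, Nat.card_eq_fintype_card, Fintype.card_coe, hR,
      card_nthRootsFinset_neg_one_pow]
  have hAB : A * B = 1 := (Matrix.mul_eq_one_comm_of_card_eq _ _ _ hcard).2 hBA
  have hpow : ∀ N : ℕ, hopMatrix n m ^ N * A = A * Matrix.diagonal D ^ N := by
    intro N
    induction N with
    | zero => simp
    | succ N ih =>
      rw [pow_succ, Matrix.mul_assoc, hHA, ← Matrix.mul_assoc, ih, Matrix.mul_assoc, ← pow_succ]
  have htr : (hopMatrix n m ^ N).trace = ∑ W, D W ^ N := by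
    rw [← Matrix.mul_one (hopMatrix n m ^ N), ← hAB, ← Matrix.mul_assoc, hpow, Matrix.mul_assoc,
      Matrix.trace_mul_comm, Matrix.mul_assoc, hBA, Matrix.mul_one, Matrix.diagonal_pow,
      Matrix.trace_diagonal]
    rfl
  rw [htr]
  have hD : ∀ W : powersetCard R m, D W = ∑ w ∈ W.1, (w : ℂ) := fun W =>
    (sum_image_enum W fun w : R => (w : ℂ)).symm
  simp only [hD]
  exact sum_powersetCard_coe R m fun z => z ^ N

end trace

/-! ### Volumes -/

/-- The uniform distribution on `[0, 1)`. -/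
noncomputable abbrev uniform : Measure ℝ := volume.restrict (Ico 0 1)

instance : IsProbabilityMeasure uniform := ⟨by simp⟩

section chambers

variable {N : ℕ}

theorem ae_injective : ∀ᵐ s ∂(Measure.pi fun _ : Fin N => uniform), Function.Injective s := by
  have h : ∀ i j : Fin N, i ≠ j →
      ∀ᵐ s ∂(Measure.pi fun _ : Fin N => uniform), s i ≠ s j := by
    intro i j hij
    rw [← Measure.restrict_pi_pi]
    refine ae_restrict_of_ae ?_
    let V : Submodule ℝ (Fin N → ℝ) :=
      LinearMap.ker ((LinearMap.proj i : (Fin N → ℝ) →ₗ[ℝ] ℝ) - LinearMap.proj j)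
    have hV : V ≠ ⊤ := by
      intro hV
      have h1 : Pi.single i (1 : ℝ) ∈ V := hV ▸ Submodule.mem_top
      simp [V, LinearMap.mem_ker, hij.symm] at h1
    have h0 := Measure.addHaar_submodule (Measure.pi fun _ : Fin N => (volume : Measure ℝ)) V hV
    rw [ae_iff]
    convert! h0 using 2
    ext s
    simp [V, LinearMap.mem_ker, sub_eq_zero]
  have h' : ∀ᵐ s ∂(Measure.pi fun _ : Fin N => uniform), ∀ i j : Fin N, i ≠ j → s i ≠ s j := by
    simp only [ae_all_iff]
    exact h
  filter_upwards [h'] with s hs i j hij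
  exact not_not.1 (mt (hs i j) (not_not.2 hij))

theorem ae_mem_Ico :
    ∀ᵐ s ∂(Measure.pi fun _ : Fin N => uniform), ∀ i, s i ∈ Ico (0 : ℝ) 1 := by
  rw [← Measure.restrict_pi_pi]
  filter_upwards [ae_restrict_mem (MeasurableSet.univ_pi fun _ => measurableSet_Ico)] with s hs i
  exact hs i (mem_univ i)

theorem measurableSet_strictMono : MeasurableSet {s : Fin N → ℝ | StrictMono s} := by
  have : {s : Fin N → ℝ | StrictMono s} = ⋂ i, ⋂ j, {s | i < j → s i < s j} := by
    ext s
    simp [StrictMono]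
  rw [this]
  refine .iInter fun i => .iInter fun j => ?_
  by_cases hij : i < j
  · simpa [hij] using measurableSet_lt (measurable_pi_apply i) (measurable_pi_apply j)
  · simp [hij]

theorem measurable_comp_perm (σ : Equiv.Perm (Fin N)) :
    Measurable fun s : Fin N → ℝ => s ∘ σ :=
  measurable_pi_lambda _ fun i => measurable_pi_apply (σ i)

theorem measurableSet_chamber (σ : Equiv.Perm (Fin N)) :
    MeasurableSet {s : Fin N → ℝ | StrictMono (s ∘ σ)} :=
  measurable_comp_perm σ measurableSet_strictMono

/-- Almost every tuple lies in one of the chambers, in each of which the order of the entries is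
fixed. -/
theorem sum_measure_chamber_inter {A : Set (Fin N → ℝ)} (hA : MeasurableSet A) :
    ∑ σ : Equiv.Perm (Fin N),
      Measure.pi (fun _ : Fin N => uniform) ({s | StrictMono (s ∘ σ)} ∩ A) =
      Measure.pi (fun _ : Fin N => uniform) A := by
  rw [← tsum_fintype (L := .unconditional _), ← measure_iUnion]
  · refine measure_congr ?_
    filter_upwards [ae_injective] with s hs
    refine propext ⟨fun h => ?_, fun h => ?_⟩
    · obtain ⟨σ, hσ⟩ := mem_iUnion.1 h
      exact hσ.2
    · refine mem_iUnion.2 ⟨Tuple.sort s, ?_, h⟩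
      exact (Tuple.monotone_sort s).strictMono_of_injective (hs.comp (Equiv.injective _))
  · intro σ τ hστ
    refine Set.disjoint_left.2 fun s hs ht => hστ ?_
    have hσ : StrictMono (s ∘ σ) := hs.1
    have hτ : StrictMono (s ∘ τ) := ht.1
    have h1 : s ∘ σ = s ∘ τ := by
      rw [← hσ.range_inj hτ, σ.surjective.range_comp, τ.surjective.range_comp]
    have hinj : Function.Injective s := by
      have := hσ.injective.comp σ.symm.injective
      simpa [Function.comp_assoc] using this
    exact Equiv.ext fun i => hinj (congrFun h1 i)
  · exact fun σ => (measurableSet_chamber σ).inter hA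

theorem measurePreserving_comp_equiv {ι ι' : Type*} [Fintype ι] [Fintype ι'] (e : ι' ≃ ι) :
    MeasurePreserving (fun s : ι → ℝ => s ∘ e) (Measure.pi fun _ => uniform)
      (Measure.pi fun _ => uniform) := by
  have h := measurePreserving_piCongrLeft (α := fun _ : ι' => ℝ) (fun _ => uniform) e.symm
  convert! h using 1
  ext s i
  simp [MeasurableEquiv.piCongrLeft, Equiv.piCongrLeft]

theorem measure_chamber (σ : Equiv.Perm (Fin N)) :
    Measure.pi (fun _ : Fin N => uniform) {s | StrictMono (s ∘ σ)} = (N ! : ENNReal)⁻¹ := by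
  have h1 : ∀ τ : Equiv.Perm (Fin N),
      Measure.pi (fun _ : Fin N => uniform) {s | StrictMono (s ∘ τ)} =
        Measure.pi (fun _ : Fin N => uniform) {s | StrictMono s} := fun τ =>
    (measurePreserving_comp_equiv τ).measure_preimage measurableSet_strictMono.nullMeasurableSet
  have h2 := sum_measure_chamber_inter (N := N) MeasurableSet.univ
  simp only [inter_univ, h1, measure_univ, Finset.sum_const, Finset.card_univ,
    Fintype.card_perm, Fintype.card_fin, nsmul_eq_mul] at h2
  rw [h1]
  exact ENNReal.eq_inv_of_mul_eq_one_left ((mul_comm _ _).trans h2)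

end chambers

section torus

variable {n N : ℕ}

theorem isConfig_comp_perm {k l : ℕ} {x : Fin N → ℝ × ZMod n} (σ : Equiv.Perm (Fin N)) :
    IsConfig k l (x ∘ σ) ↔ IsConfig k l x := by
  constructor
  · rintro ⟨t, ht, e, he⟩
    refine ⟨t, ht, σ.symm.trans e, fun i => ?_⟩
    simpa using he (σ.symm i)
  · rintro ⟨t, ht, e, he⟩
    exact ⟨t, ht, σ.trans e, fun i => he (σ i)⟩

/-- The tuples whose entries form a configuration, numbered according to `e`. -/
def numberedConfigs (k l : ℕ) (e : Fin N ≃ ZMod n × Fin k) :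
    Set (Fin N → ℝ × ZMod n) :=
  {x | (fun h j => (x (e.symm (h, j))).1) ∈ configs n k l ∧ ∀ i, (x i).2 = (e i).1}

theorem setOf_isConfig (k l : ℕ) :
    {x : Fin N → ℝ × ZMod n | IsConfig k l x} =
      ⋃ e : Fin N ≃ ZMod n × Fin k, numberedConfigs k l e := by
  ext x
  rw [mem_iUnion]
  constructor
  · rintro ⟨t, ht, e, he⟩
    refine ⟨e, ?_, fun i => by rw [he]⟩
    convert! ht
    simp [he]
  · rintro ⟨e, h1, h2⟩
    exact ⟨_, h1, e, fun i => Prod.ext (by simp) (h2 i)⟩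

/-- As the points of each string are numbered from left to right, the numbering is unique. -/
theorem numberedConfigs_inj {k l : ℕ} {e e' : Fin N ≃ ZMod n × Fin k}
    {x : Fin N → ℝ × ZMod n} (hx : x ∈ numberedConfigs k l e)
    (hx' : x ∈ numberedConfigs k l e') : e = e' := by
  have hinj : Function.Injective x := by
    intro i i' hii
    have h1 : (e i).1 = (e i').1 := by rw [← hx.2, ← hx.2, hii]
    refine e.injective (Prod.ext h1 ((hx.1.1.strictMono (e i).1).injective ?_))
    have h2 : ((e i).1, (e i').2) = e i' := Prod.ext h1 rfl
    simp [h2, hii]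
  have hrange : ∀ {e : Fin N ≃ ZMod n × Fin k}, x ∈ numberedConfigs k l e → ∀ h,
      range (fun j => (x (e.symm (h, j))).1) = {a | (a, h) ∈ range x} := by
    intro e hx h
    ext a
    constructor
    · rintro ⟨j, rfl⟩
      exact ⟨e.symm (h, j), Prod.ext rfl (by simp [hx.2])⟩
    · rintro ⟨i, hi⟩
      have h1 : (e i).1 = h := by rw [← hx.2, hi]
      refine ⟨(e i).2, ?_⟩
      have h2 : (h, (e i).2) = e i := Prod.ext h1.symm rfl
      simp [h2, hi]
  refine Equiv.symm_bijective.injective (Equiv.ext fun p => hinj (Prod.ext ?_ ?_))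
  · have := ((hx.1.1.strictMono p.1).range_inj (hx'.1.1.strictMono p.1)).1
      ((hrange hx p.1).trans (hrange hx' p.1).symm)
    exact congrFun this p.2
  · rw [hx.2, hx'.2]
    simp

variable [NeZero n]

instance : SigmaFinite (torusMeasure n) :=
  inferInstanceAs (SigmaFinite (uniform.prod Measure.count))

theorem torusMeasurePow_apply {S : Set (Fin N → ℝ × ZMod n)} (hS : MeasurableSet S) :
    torusMeasurePow n N S = ∑ w : Fin N → ZMod n,
      Measure.pi (fun _ : Fin N => uniform) {s | (fun i => (s i, w i)) ∈ S} := by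
  let T := MeasurableEquiv.arrowProdEquivProdArrow ℝ (ZMod n) (Fin N)
  have h := (measurePreserving_arrowProdEquivProdArrow ℝ (ZMod n) (Fin N) (fun _ => uniform)
    (fun _ => Measure.count)).symm T
  have h1 := h.measure_preimage hS.nullMeasurableSet
  change _ = torusMeasurePow n N S at h1
  rw [← h1, Measure.prod_apply_symm (T.symm.measurable hS), lintegral_fintype]
  refine Finset.sum_congr rfl fun w _ => ?_
  rw [Measure.pi_singleton]
  simp only [Measure.count_singleton, Finset.prod_const_one, mul_one]
  rfl

instance : IsFiniteMeasure (torusMeasurePow n N) := by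
  refine ⟨?_⟩
  rw [torusMeasurePow_apply MeasurableSet.univ]
  simp

theorem IsConfig.eq_mul {k l : ℕ} {x : Fin N → ℝ × ZMod n} (h : IsConfig k l x) : N = n * k := by
  obtain ⟨t, ht, e, he⟩ := h
  simpa using Fintype.card_congr e

theorem measurableSet_numberedConfigs {k : ℕ} (hk : k ≠ 0) (l : ℕ)
    (e : Fin N ≃ ZMod n × Fin k) : MeasurableSet (numberedConfigs k l e) := by
  have h : numberedConfigs k l e = {x | (fun h j => (x (e.symm (h, j))).1) ∈ configs n k l} ∩
      ⋂ i, {x | (x i).2 = (e i).1} := by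
    ext x
    simp [numberedConfigs]
  rw [h]
  refine (measurableSet_configs hk l |>.preimage ?_).inter (.iInter fun i => ?_)
  · fun_prop
  · have : Measurable fun x : Fin N → ℝ × ZMod n => (x i).2 := by fun_prop
    exact this (measurableSet_singleton (e i).1)

theorem measurableSet_isConfig {k : ℕ} (hk : k ≠ 0) (l : ℕ) :
    MeasurableSet {x : Fin N → ℝ × ZMod n | IsConfig k l x} := by
  rw [setOf_isConfig]
  exact .iUnion fun e => measurableSet_numberedConfigs hk l e

theorem IsConfig.ne_zero {k l : ℕ} (hN : N ≠ 0) {x : Fin N → ℝ × ZMod n}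
    (h : IsConfig k l x) : k ≠ 0 := by
  rintro rfl
  exact hN (by simpa using h.eq_mul)

theorem measurableSet_exists_isConfig (hN : N ≠ 0) (l : ℕ) :
    MeasurableSet {x : Fin N → ℝ × ZMod n | ∃ k, IsConfig k l x} := by
  have : {x : Fin N → ℝ × ZMod n | ∃ k, IsConfig k l x} =
      ⋃ k : {k : ℕ // k ≠ 0}, {x | IsConfig k l x} := by
    ext x
    simp only [mem_iUnion]
    exact ⟨fun ⟨k, hk⟩ => ⟨⟨k, hk.ne_zero hN⟩, hk⟩, fun ⟨k, hk⟩ => ⟨k, hk⟩⟩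
  rw [this]
  exact .iUnion fun k => measurableSet_isConfig k.2 l

theorem IsWalk.visits_ne_zero (hN : N ≠ 0) {w : Fin N → ZMod n} {X : Finset (ZMod n)}
    (h : IsWalk w X X) : visits w 0 N ≠ 0 := by
  intro h0
  have h1 := sum_visits w
  simp only [h.isConfigWord.total, h0, Finset.sum_const_zero] at h1
  exact hN h1.symm

theorem exists_isConfig_iff_exists_isWalk (hN : N ≠ 0) {l : ℕ} (hl : l ≤ n) {s : Fin N → ℝ}
    (hs : StrictMono s) (hs1 : ∀ i, s i ∈ Ico (0 : ℝ) 1) (w : Fin N → ZMod n) :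
    (∃ k, IsConfig k l (fun i => (s i, w i))) ↔ ∃ X, X.card = n - l ∧ IsWalk w X X := by
  constructor
  · rintro ⟨k, hk⟩
    obtain ⟨O, hO, hw⟩ :=
      (isConfig_iff_isConfigWord (hk.ne_zero hN) l hs hs1 w).1 hk
    exact ⟨Oᶜ, by rw [Finset.card_compl, ZMod.card, hO], hw.isWalk⟩
  · rintro ⟨X, hX, hw⟩
    exact ⟨_, (isConfig_iff_isConfigWord (hw.visits_ne_zero hN) l hs hs1 w).2
      ⟨Xᶜ, by rw [Finset.card_compl, ZMod.card, hX]; omega, hw.isConfigWord⟩⟩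

open Classical in
theorem trace_hopMatrix_pow_eq_card (hN : N ≠ 0) (m : ℕ) :
    (hopMatrix n m ^ N).trace = ((Finset.univ.filter fun w : Fin N → ZMod n =>
      ∃ X, X.card = m ∧ IsWalk w X X).card : ℂ) := by
  simp only [Matrix.trace, Matrix.diag_apply, hopMatrix_pow_apply]
  rw [Finset.sum_comm, Finset.card_filter, Nat.cast_sum]
  refine Finset.sum_congr rfl fun w _ => ?_
  split_ifs with hw
  · obtain ⟨X, hX, hw⟩ := hw
    rw [Finset.sum_eq_single (⟨X, hX⟩ : powersetCard (ZMod n) m), if_pos hw, Nat.cast_one]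
    · intro Y _ hY
      rw [if_neg]
      intro hwY
      refine hY (Subtype.ext (compl_injective ?_))
      exact hwY.isConfigWord.unique (hwY.visits_ne_zero hN) hw.isConfigWord
    · simp
  · rw [Nat.cast_zero]
    exact Finset.sum_eq_zero fun X _ => if_neg fun h => hw ⟨X.1, X.2, h⟩

/-- The volume of the labelled configurations is the number of their words: there are `N!` orders
in which `N` labelled points can be met, and each has volume `1 / N!`. -/
theorem torusMeasurePow_exists_isConfig (hN : N ≠ 0) {l : ℕ} (hl : l ≤ n) :
    ((torusMeasurePow n N {x | ∃ k, IsConfig k l x}).toReal : ℂ) =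
      (hopMatrix n (n - l) ^ N).trace := by
  classical
  have hS := measurableSet_exists_isConfig (n := n) hN l
  let G : Finset (Fin N → ZMod n) :=
    Finset.univ.filter fun w => ∃ X, X.card = n - l ∧ IsWalk w X X
  have key : ∀ (w : Fin N → ZMod n) (σ : Equiv.Perm (Fin N)),
      Measure.pi (fun _ : Fin N => uniform) ({s | StrictMono (s ∘ σ)} ∩
        {s | (fun i => (s i, w i)) ∈ {x : Fin N → ℝ × ZMod n | ∃ k, IsConfig k l x}}) =
      if w ∘ σ ∈ G then (N ! : ENNReal)⁻¹ else 0 := by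
    intro w σ
    have h1 : ∀ᵐ s ∂(Measure.pi fun _ : Fin N => uniform), StrictMono (s ∘ σ) →
        ((∃ k, IsConfig k l fun i => (s i, w i)) ↔ w ∘ σ ∈ G) := by
      filter_upwards [ae_mem_Ico] with s hs hmono
      rw [Finset.mem_filter_univ,
        ← exists_isConfig_iff_exists_isWalk hN hl hmono (fun i => hs (σ i))]
      exact exists_congr fun k => (isConfig_comp_perm σ).symm
    split_ifs with hw
    · rw [← measure_chamber σ]
      refine measure_congr ?_
      filter_upwards [h1] with s hs
      exact propext ⟨fun h => h.1, fun h => ⟨h, (hs h).2 hw⟩⟩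
    · rw [← measure_empty (μ := Measure.pi fun _ : Fin N => uniform)]
      refine measure_congr ?_
      filter_upwards [h1] with s hs
      exact propext ⟨fun h => hw ((hs h.1).1 h.2), fun h => h.elim⟩
  have hm : ∀ w : Fin N → ZMod n, MeasurableSet
      {s : Fin N → ℝ | (fun i => (s i, w i)) ∈ {x : Fin N → ℝ × ZMod n | ∃ k, IsConfig k l x}} := by
    intro w
    have : Measurable fun (s : Fin N → ℝ) (i : Fin N) => (s i, w i) := by fun_prop
    exact this hS
  have h2 : torusMeasurePow n N {x | ∃ k, IsConfig k l x} = (G.card : ENNReal) := by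
    rw [torusMeasurePow_apply hS]
    simp only [← sum_measure_chamber_inter (hm _), key]
    rw [Finset.sum_comm]
    have h3 : ∀ σ : Equiv.Perm (Fin N), ∑ w : Fin N → ZMod n,
        (if w ∘ σ ∈ G then (N ! : ENNReal)⁻¹ else 0) = G.card * (N ! : ENNReal)⁻¹ := by
      intro σ
      have := (Equiv.arrowCongr σ.symm (Equiv.refl (ZMod n))).sum_comp
        fun w => if w ∈ G then (N ! : ENNReal)⁻¹ else 0
      rw [Finset.sum_ite_mem, Finset.univ_inter, Finset.sum_const, nsmul_eq_mul] at this
      exact this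
    simp only [h3, Finset.sum_const, Finset.card_univ, Fintype.card_perm, Fintype.card_fin,
      nsmul_eq_mul]
    rw [mul_left_comm, ENNReal.mul_inv_cancel (by exact_mod_cast N.factorial_ne_zero) (by simp),
      mul_one]
  rw [h2, trace_hopMatrix_pow_eq_card hN]
  simp [G]

theorem setOf_exists_isConfig (k l : ℕ) :
    {x : Fin (n * k) → ℝ × ZMod n | ∃ k', IsConfig k' l x} = {x | IsConfig k l x} := by
  ext x
  refine ⟨fun ⟨k', h⟩ => ?_, fun h => ⟨k, h⟩⟩
  obtain rfl := Nat.eq_of_mul_eq_mul_left (Nat.pos_of_ne_zero (NeZero.ne n)) h.eq_mul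
  exact h

theorem labelledVol_eq_trace (k : ℕ) {l : ℕ} (hl : l ≤ n) :
    (labelledVol n k l : ℂ) = (hopMatrix n (n - l) ^ (n * k)).trace := by
  rw [labelledVol]
  split_ifs with hk
  · subst hk
    rw [mul_zero, pow_zero, Matrix.trace_one, ← Nat.card_eq_fintype_card, powersetCard.card,
      Nat.card_zmod, Nat.choose_symm hl]
    simp
  · rw [← setOf_exists_isConfig]
    exact torusMeasurePow_exists_isConfig (mul_ne_zero (NeZero.ne n) hk) hl

theorem measurePreserving_curry {ι κ : Type*} [Fintype ι] [Fintype κ] :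
    MeasurePreserving (fun (s : ι × κ → ℝ) i j => s (i, j)) (Measure.pi fun _ => uniform)
      (Measure.pi fun _ => Measure.pi fun _ => uniform) where
  measurable := by fun_prop
  map_eq := by
    have := Measure.infinitePi_map_curry (fun (_ : ι) (_ : κ) => uniform)
    simp only [Measure.infinitePi_eq_pi] at this
    exact this

theorem torusMeasurePow_numberedConfigs {k : ℕ} (hk : k ≠ 0) (l : ℕ)
    (e : Fin N ≃ ZMod n × Fin k) :
    torusMeasurePow n N (numberedConfigs k l e) = volume (configs n k l) := by
  have hsub : configs n k l ⊆ univ.pi fun _ => univ.pi fun _ => Ico 0 1 :=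
    fun t ht h _ j _ => ht.1.mem_Ico h j
  have h1 : volume (configs n k l) =
      (Measure.pi fun _ : ZMod n => Measure.pi fun _ : Fin k => uniform) (configs n k l) := by
    simp only [← Measure.restrict_pi_pi]
    rw [Measure.restrict_apply (measurableSet_configs hk l), inter_eq_left.2 hsub]
    rfl
  have h2 := (measurePreserving_curry.comp (measurePreserving_comp_equiv e.symm)).measure_preimage
    (measurableSet_configs (n := n) hk l).nullMeasurableSet
  rw [h1, ← h2, torusMeasurePow_apply (measurableSet_numberedConfigs hk l e),
    Finset.sum_eq_single fun i => (e i).1]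
  · congr 1
    ext s
    simp [numberedConfigs]
  · intro w _ hw
    convert! measure_empty (μ := Measure.pi fun _ : Fin N => uniform)
    rw [Set.eq_empty_iff_forall_notMem]
    exact fun s hs => hw (funext hs.2)
  · simp

theorem labelledVol_eq_factorial_mul_Vol (k l : ℕ) :
    labelledVol n k l = (n * k)! * Vol n k l := by
  rw [labelledVol, Vol]
  split_ifs with hk
  · simp [hk]
  · rw [setOf_isConfig, measure_iUnion, tsum_fintype]
    · simp only [torusMeasurePow_numberedConfigs hk, Finset.sum_const, Finset.card_univ,
        nsmul_eq_mul, ENNReal.toReal_mul, ENNReal.toReal_natCast]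
      congr 2
      have e : Fin (n * k) ≃ ZMod n × Fin k := Fintype.equivOfCardEq (by simp)
      rw [Fintype.card_equiv e, Fintype.card_fin]
    · intro e e' hee'
      exact Set.disjoint_left.2 fun x hx hx' => hee' (numberedConfigs_inj hx hx')
    · exact fun e => measurableSet_numberedConfigs hk l e

end torus

/-! ### The partition function -/

section partition

variable {n : ℕ}

theorem g_eq_sum_indicator {N : ℕ} (hN : N ≠ 0) (lam : ℂ) :
    g n N lam = fun x => ∑ l ∈ Finset.range (n + 1),
      {x | ∃ k, IsConfig k l x}.indicator (fun _ => Complex.exp (-lam * l)) x := by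
  ext x
  rw [g, if_neg hN]
  refine Finset.sum_congr rfl fun l _ => ?_
  by_cases h : ∃ k, IsConfig k l x
  · rw [if_pos h, indicator_of_mem (by exact h)]
  · rw [if_neg h, indicator_of_notMem (by exact h)]

theorem g_zero (lam : ℂ) :
    g n 0 lam = fun _ => ∑ l ∈ Finset.range (n + 1), (n.choose l : ℂ) * Complex.exp (-lam * l) := by
  ext x
  rw [g, if_pos rfl]

variable [NeZero n]

/-- In a closed walk all letters occur equally often, so its length is a multiple of `n`. -/
theorem trace_hopMatrix_pow_eq_zero {N : ℕ} (m : ℕ) (hN : ¬ n ∣ N) :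
    (hopMatrix n m ^ N).trace = 0 := by
  have hN0 : N ≠ 0 := fun h => hN (h ▸ dvd_zero n)
  rw [trace_hopMatrix_pow_eq_card hN0, Nat.cast_eq_zero, Finset.card_eq_zero,
    Finset.filter_eq_empty_iff]
  rintro w - ⟨X, -, hw⟩
  have h := sum_visits w
  simp only [hw.isConfigWord.total, Finset.sum_const, Finset.card_univ, ZMod.card,
    smul_eq_mul] at h
  exact hN ⟨_, h.symm⟩

theorem integrable_g (N : ℕ) (lam : ℂ) : Integrable (g n N lam) (torusMeasurePow n N) := by
  by_cases hN : N = 0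
  · subst hN
    rw [g_zero]
    exact integrable_const _
  · rw [g_eq_sum_indicator hN]
    exact integrable_finsetSum _ fun l _ =>
      (integrable_const _).indicator (measurableSet_exists_isConfig hN l)

theorem trace_hopMatrix_pow_zero (m : ℕ) : (hopMatrix n m ^ 0).trace = n.choose m := by
  rw [pow_zero, Matrix.trace_one, ← Nat.card_eq_fintype_card, powersetCard.card, Nat.card_zmod]

theorem integral_g (N : ℕ) (lam : ℂ) :
    ∫ x, g n N lam x ∂(torusMeasurePow n N) =
      ∑ l ∈ Finset.range (n + 1), Complex.exp (-lam * l) * (hopMatrix n (n - l) ^ N).trace := by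
  by_cases hN : N = 0
  · subst hN
    have h1 : (torusMeasurePow n 0).real univ = 1 := by
      rw [Measure.real, torusMeasurePow_apply MeasurableSet.univ]
      simp
    rw [g_zero, integral_const, h1, one_smul]
    refine Finset.sum_congr rfl fun l hl => ?_
    rw [trace_hopMatrix_pow_zero, Nat.choose_symm (Nat.lt_succ_iff.1 (Finset.mem_range.1 hl)),
      mul_comm]
  · rw [g_eq_sum_indicator hN, integral_finsetSum]
    · refine Finset.sum_congr rfl fun l hl => ?_
      rw [integral_indicator_const _ (measurableSet_exists_isConfig hN l), Complex.real_smul,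
        Measure.real, torusMeasurePow_exists_isConfig hN
          (Nat.lt_succ_iff.1 (Finset.mem_range.1 hl)), mul_comm]
    · exact fun l _ => (integrable_const _).indicator (measurableSet_exists_isConfig hN l)

/-- The `m`-th elementary symmetric polynomial of the numbers `e ^ (T w)`, where `w ^ n = a`. -/
noncomputable def expSum (n m : ℕ) (a T : ℂ) : ℂ :=
  ∑ W ∈ (Polynomial.nthRootsFinset n a).powersetCard m, Complex.exp (T * ∑ w ∈ W, w)

theorem hasSum_trace_hopMatrix_pow (m : ℕ) (T : ℂ) :
    HasSum (fun N : ℕ => T ^ N / (N ! : ℂ) * (hopMatrix n m ^ N).trace)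
      (expSum n m ((-1) ^ (m + 1)) T) := by
  simp only [trace_hopMatrix_pow, Finset.mul_sum]
  refine hasSum_sum fun W _ => ?_
  have := NormedSpace.expSeries_div_hasSum_exp (𝔸 := ℂ) (T * ∑ w ∈ W, w)
  rw [← Complex.exp_eq_exp_ℂ] at this
  convert! this using 2 with N
  rw [mul_pow]
  ring

theorem hasSum_comp_mul {f : ℕ → ℂ} {a : ℂ} (hf : ∀ N, ¬ n ∣ N → f N = 0) (h : HasSum f a) :
    HasSum (fun k => f (n * k)) a := by
  have hinj : Function.Injective fun k : ℕ => n * k := fun a b h =>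
    Nat.eq_of_mul_eq_mul_left (Nat.pos_of_ne_zero (NeZero.ne n)) h
  exact (hinj.hasSum_iff fun N hN => hf N fun ⟨k, hk⟩ => hN ⟨k, hk.symm⟩).2 h

theorem hasSum_trace_hopMatrix_pow_mul (m : ℕ) (T : ℂ) :
    HasSum (fun k : ℕ => T ^ (n * k) / ((n * k)! : ℂ) * (hopMatrix n m ^ (n * k)).trace)
      (expSum n m ((-1) ^ (m + 1)) T) :=
  hasSum_comp_mul (f := fun N => T ^ N / (N ! : ℂ) * (hopMatrix n m ^ N).trace)
    (fun N hN => by rw [trace_hopMatrix_pow_eq_zero m hN, mul_zero])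
    (hasSum_trace_hopMatrix_pow m T)

theorem hasSum_Z (lam T : ℂ) :
    HasSum (fun N : ℕ => T ^ N / (N ! : ℂ) * ∫ x, g n N lam x ∂(torusMeasurePow n N))
      (∑ l ∈ Finset.range (n + 1),
        Complex.exp (-lam * l) * expSum n (n - l) ((-1) ^ (n - l + 1)) T) := by
  simp only [integral_g, Finset.mul_sum]
  refine hasSum_sum fun l _ => ?_
  convert! (hasSum_trace_hopMatrix_pow (n - l) T).mul_left (Complex.exp (-lam * l)) using 2
  ring

theorem hasSum_prod_fintype {ι κ : Type*} [Fintype κ] {f : ι × κ → ℂ} {a : κ → ℂ}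
    (h : ∀ j, HasSum (fun i => f (i, j)) (a j)) : HasSum f (∑ j, a j) := by
  classical
  have h1 : ∀ j, HasSum (fun p : ι × κ => if p.2 = j then f p else 0) (a j) := by
    intro j
    have hinj : Function.Injective fun i : ι => (i, j) := fun i i' h => (Prod.mk.inj h).1
    refine (hinj.hasSum_iff fun p hp => if_neg fun hpj => hp ⟨p.1, ?_⟩).1 ?_
    · rw [← hpj]
    · simpa [Function.comp_def] using h j
  simpa using hasSum_sum fun j (_ : j ∈ Finset.univ) => h1 j

theorem hasSum_prod_Z (lam T : ℂ) :
    HasSum (fun p : ℕ × Fin (n + 1) => T ^ (n * p.1) / ((n * p.1)! : ℂ) *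
      Complex.exp (-lam * (p.2 : ℕ)) * (labelledVol n p.1 p.2 : ℂ)) (Z n lam T) := by
  rw [Z, (hasSum_Z lam T).tsum_eq, Finset.sum_range]
  refine hasSum_prod_fintype fun l => ?_
  convert! (hasSum_trace_hopMatrix_pow_mul (n - l) T).mul_left (Complex.exp (-lam * (l : ℕ)))
    using 2 with k
  rw [labelledVol_eq_trace k (Nat.lt_succ_iff.1 l.2)]
  ring

theorem prod_exp_sub (j : ℕ) (T c : ℂ) :
    ∏ w ∈ Polynomial.nthRootsFinset n ((-1 : ℂ) ^ j), (Complex.exp (T * w) - c) =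
      ∑ m ∈ Finset.range (n + 1), (-c) ^ (n - m) * expSum n m ((-1) ^ j) T := by
  classical
  simp only [sub_eq_add_neg]
  rw [Finset.prod_add, Finset.sum_powerset, card_nthRootsFinset_neg_one_pow]
  refine Finset.sum_congr rfl fun m _ => ?_
  rw [expSum, Finset.mul_sum]
  refine Finset.sum_congr rfl fun W hW => ?_
  obtain ⟨hsub, rfl⟩ := Finset.mem_powersetCard.1 hW
  rw [Finset.prod_const, Finset.card_sdiff_of_subset hsub, card_nthRootsFinset_neg_one_pow,
    Finset.mul_sum, Complex.exp_sum, mul_comm]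

/-- The sum over the signs selects the roots of `1` when the number `m` of holes is odd, and those
of `-1` when it is even. -/
theorem half_sum_sign {m : ℕ} (hm : m ≤ n) (q : ℂ) (E : ℂ → ℂ) :
    1 / 2 * ∑ θ : Fin 2 × Fin 2, (-1 : ℂ) ^ (((θ.1 : ℕ) + 1) * ((θ.2 : ℕ) + n + 1)) *
      ((-((-1 : ℂ) ^ (θ.1 : ℕ) * q)) ^ (n - m) * E ((-1) ^ (θ.2 : ℕ))) =
      q ^ (n - m) * E ((-1) ^ (m + 1)) := by
  obtain ⟨l, rfl⟩ := Nat.exists_eq_add_of_le hm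
  simp only [Fintype.sum_prod_type, Fin.sum_univ_two, Fin.val_zero, Fin.val_one, pow_zero,
    pow_one, add_tsub_cancel_left, one_mul, neg_mul, neg_neg, zero_add, neg_pow q]
  rcases Nat.even_or_odd m with h | h <;> rcases Nat.even_or_odd l with h' | h' <;>
    simp [h.neg_one_pow, h'.neg_one_pow, pow_add, pow_mul] <;> ring

theorem Z_eq (lam T : ℂ) :
    Z n lam T = 1 / 2 * ∑ θ : Fin 2 × Fin 2,
      (-1 : ℂ) ^ (((θ.1 : ℕ) + 1) * ((θ.2 : ℕ) + n + 1)) *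
        ∏ w ∈ Polynomial.nthRootsFinset n ((-1 : ℂ) ^ (θ.2 : ℕ)),
          (Complex.exp (T * w) - (-1 : ℂ) ^ (θ.1 : ℕ) * Complex.exp (-lam)) := by
  simp only [prod_exp_sub, Finset.mul_sum (Finset.range (n + 1))]
  rw [Finset.sum_comm, Finset.mul_sum, Z, (hasSum_Z lam T).tsum_eq,
    ← Finset.sum_range_reflect]
  refine Finset.sum_congr rfl fun m hm => ?_
  have hm := Nat.lt_succ_iff.1 (Finset.mem_range.1 hm)
  rw [half_sum_sign hm (Complex.exp (-lam)) fun a => expSum n m a T, ← Complex.exp_nat_mul,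
    show n + 1 - 1 - m = n - m by omega, Nat.sub_sub_self hm, mul_comm (-lam)]

end partition

end BeadModel

theorem theorem1p1 (n : ℕ) [NeZero n] (lam T : ℂ) :
    (∀ N : ℕ, Integrable (BeadModel.g n N lam) (BeadModel.torusMeasurePow n N)) ∧
    Summable (fun N : ℕ =>
      T ^ N / (N ! : ℂ) * ∫ x, BeadModel.g n N lam x ∂(BeadModel.torusMeasurePow n N)) ∧
    HasSum (fun p : ℕ × Fin (n + 1) =>
      T ^ (n * p.1) / ((n * p.1)! : ℂ) * Complex.exp (-lam * (p.2 : ℕ)) *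
        (BeadModel.labelledVol n p.1 p.2 : ℂ)) (BeadModel.Z n lam T) ∧
    HasSum (fun p : ℕ × Fin (n + 1) =>
      T ^ (n * p.1) * Complex.exp (-lam * (p.2 : ℕ)) * (BeadModel.Vol n p.1 p.2 : ℂ))
      (BeadModel.Z n lam T) ∧
    BeadModel.Z n lam T =
      1 / 2 * ∑ θ : Fin 2 × Fin 2,
        (-1 : ℂ) ^ (((θ.1 : ℕ) + 1) * ((θ.2 : ℕ) + n + 1)) *
          ∏ w ∈ Polynomial.nthRootsFinset n ((-1 : ℂ) ^ (θ.2 : ℕ)),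
            (Complex.exp (T * w) - (-1 : ℂ) ^ (θ.1 : ℕ) * Complex.exp (-lam)) := by
  refine ⟨fun N => BeadModel.integrable_g N lam, (BeadModel.hasSum_Z lam T).summable,
    BeadModel.hasSum_prod_Z lam T, ?_, BeadModel.Z_eq lam T⟩
  convert! BeadModel.hasSum_prod_Z lam T using 2 with p
  rw [BeadModel.labelledVol_eq_factorial_mul_Vol]
  have : ((n * p.1)! : ℂ) ≠ 0 := by exact_mod_cast Nat.factorial_ne_zero _
  push_cast
  field_simp
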